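/- Let $a_1,a_2,b\in\mathbb R$. For a sampling period $h>0$ put $t_k=kh$, $k=0,1,2,\dots$. Let $q\in\mathbb N$, gains $k_p,k_i,k_d\in\mathbb R$ and a threshold $\sigma\in[0,1)$ be given. The event-triggered PID controller is defined by $$u(t_k)=k_py(t_k)+k_ih\sum_{j=0}^{k-1}y(t_j)+k_d\,y(t_{k-q}),\qquad y(t_{k-q})=0\ \text{for } k<q,$$ $\hat u_0=u(t_0)$ and, for $k\ge1$, $\hat u_k=u(t_k)$ if $(u(t_k)-\hat u_{k-1})^2>\sigma u(t_k)^2$ and $\hat u_k=\hat u_{k-1}$ otherwise. It is applied to the plant $$\ddot y(t)+a_1\dot y(t)+a_2y(t)=b\hat u_k,\qquad t\in[t_k,t_{k+1}),\ k=0,1,2,\dots,\tag{1}$$ where $y,\dot y$ are continuous on $[0,\infty)$. The continuous PID controller $u(t)=\bar k_py(t)+\bar k_i\int_0^ty(s)\,ds+\bar k_d\dot y(t)$ is applied to the plant $$\ddot y(t)+a_1\dot y(t)+a_2y(t)=bu(t),\qquad t\ge0.\tag{2}$$ A controller exponentially stabilizes its plant with decay rate $\alpha$ if there is a constant $M$ such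 that all solutions satisfy $\|\xi(t)\|\le Me^{-\alpha t}\|\xi(0)\|$ for all $t\ge0$, where $\xi=(y,\dot y)$. It does so including the integral state if the same holds for $\xi=(y,\dot y,x_3)$, where $x_3(t)=\int_0^ty(s)\,ds$ for (2), and $x_3(t)=(t-t_k)y(t_k)+h\sum_{j=0}^{k-1}y(t_j)$ on $[t_k,t_{k+1})$ for (1). (i) Let $h>0$, $q\ge1$, $k_p,k_i,k_d\in\mathbb R$, $\sigma\in[0,1)$, $\alpha>0$. Put $$A=\begin{bmatrix}0&1&0\\-a_2+b(k_p+k_d)&-a_1-qhbk_d&bk_i\\1&0&0\end{bmatrix},\quad A_v=\begin{bmatrix}0&0&0\\bk_p&0&bk_i\\1&0&0\end{bmatrix},\quad B=\begin{bmatrix}0\\b\\0\end{bmatrix},\quad E=\begin{bmatrix}0&0&0\\0&1&0\\0&0&0\end{bmatrix}.$$ Suppose that there are positive definite $P,S\in\mathbb R^{3\times3}$ and nonnegative scalars $W,R,\omega$ such that $\Psi\le0$ (negative semidefinite), where, with $G=h^2e^{2\alpha h}S+R\,k_d^2(qh)^2E$, $\Psi=\{\Psi_{ij}\}_{i,j=1}^7$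 is the symmetric block matrix whose nonzero blocks with $i\le j$ are $$\begin{aligned} &\Psi_{11}=PA+A^TP+2\alpha P+Wk_d^2h^2e^{2\alpha h}E,\quad \Psi_{12}=\sqrt h\,PA_v,\quad \Psi_{13}=\Psi_{14}=\Psi_{15}=PB,\\ &\Psi_{16}=\omega\sigma\,[k_p+k_d,\,-qhk_d,\,k_i]^T,\quad \Psi_{17}=A^TG,\\ &\Psi_{22}=-\tfrac{\pi^2}{4}hS,\quad \Psi_{26}=\omega\sigma\sqrt h\,[k_p,\,0,\,k_i]^T,\quad \Psi_{27}=\sqrt h\,A_v^TG,\\ &\Psi_{33}=-W\tfrac{\pi^2}{4}e^{-2\alpha qh},\quad \Psi_{44}=-R\tfrac{4}{(qh)^2}e^{-2\alpha qh},\quad \Psi_{36}=\Psi_{46}=\omega\sigma,\\ &\Psi_{37}=\Psi_{47}=\Psi_{57}=B^TG,\quad \Psi_{55}=-\omega,\quad \Psi_{66}=-\omega\sigma,\quad \Psi_{77}=-G. \end{aligned}$$ Then the event-triggered PID controller exponentially stabilizes (1) with decay rate $\alpha$, also including the integral state. (ii) Let $\alpha'>0$ and let $\bar k_p,\bar k_i,\bar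 k_d$ be such that the continuous PID controller exponentially stabilizes (2) with decay rate $\alpha'$. Then for every $\alpha<\alpha'$ there are $h_0,\sigma_0>0$ such that for all $h\in(0,h_0)$ and all $\sigma\in[0,1)$ with $\sigma<\sigma_0$ the event-triggered PID controller with $$q=\lfloor h^{-1/2}\rfloor,\qquad k_p=\bar k_p+\frac{\bar k_d}{qh},\qquad k_i=\bar k_i,\qquad k_d=-\frac{\bar k_d}{qh}$$ exponentially stabilizes (1) with decay rate $\alpha$. The same holds with "exponentially stabilizes" read as including the integral state both in the hypothesis and in the conclusion. -/

import Mathlib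

open scoped Matrix

noncomputable section

namespace PID

/-! ### Continuous-time PID control -/

/-- The PID control law `u(t) = kp y(t) + ki ∫₀ᵗ y(s) ds + kd y'(t)`; here `dy` is the
derivative of `y`. -/
def pidControl (kp ki kd : ℝ) (y dy : ℝ → ℝ) (t : ℝ) : ℝ :=
  kp * y t + ki * (∫ s in (0 : ℝ)..t, y s) + kd * dy t

/-- `y`, with derivative `dy`, solves `y'' + a₁ y' + a₂ y = b u` on `[0, ∞)` under the PID
control law `u = pidControl kp ki kd y dy`. -/
structure IsPIDSolution (a₁ a₂ b kp ki kd : ℝ) (y dy : ℝ → ℝ) : Prop where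
  hasDeriv_y : ∀ t, 0 ≤ t → HasDerivWithinAt y (dy t) (Set.Ici 0) t
  hasDeriv_dy : ∀ t, 0 ≤ t →
    HasDerivWithinAt dy (b * pidControl kp ki kd y dy t - a₁ * dy t - a₂ * y t) (Set.Ici 0) t

/-! ### Event-triggered sampled-data PID control -/

/-- The delayed sample `y(t_{k-q})`, which is `0` for `k < q`. -/
def delayedSample (h : ℝ) (q : ℕ) (y : ℝ → ℝ) (k : ℕ) : ℝ :=
  if k < q then 0 else y (((k - q : ℕ) : ℝ) * h)

/-- The sampled-data control value `u(t_k)`, where `t_k = k h`: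
`u(t_k) = kp y(t_k) + ki h ∑_{j=0}^{k-1} y(t_j) + kd y(t_{k-q})`. -/
def sampledControl (h : ℝ) (q : ℕ) (kp ki kd : ℝ) (y : ℝ → ℝ) (k : ℕ) : ℝ :=
  kp * y ((k : ℝ) * h) + ki * h * (∑ j ∈ Finset.range k, y ((j : ℝ) * h))
    + kd * delayedSample h q y k

/-- The event-triggered control `û_k` made from the values `u k = u(t_k)`: `û_0 = u(t_0)`, and
`û_k` is `u(t_k)` if `(u(t_k) - û_{k-1})² > σ u(t_k)²`, and `û_{k-1}` otherwise. -/
def eventControl (σ : ℝ) (u : ℕ → ℝ) : ℕ → ℝ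
  | 0 => u 0
  | k + 1 =>
    if (u (k + 1) - eventControl σ u k) ^ 2 > σ * u (k + 1) ^ 2 then u (k + 1)
    else eventControl σ u k

/-- `y`, with derivative `dy`, solves `y'' + a₁ y' + a₂ y = b û_k` on `[t_k, t_{k+1})`,
`k = 0, 1, 2, …`, where `t_k = k h` and `û_k` is the event-triggered sampled-data PID control.
Both `y` and `y'` are continuous on `[0, ∞)`; the second derivative at `t_k` is one-sided. -/
structure IsEventSolution (a₁ a₂ b h : ℝ) (q : ℕ) (kp ki kd σ : ℝ) (y dy : ℝ → ℝ) : Prop where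
  hasDeriv_y : ∀ t, 0 ≤ t → HasDerivWithinAt y (dy t) (Set.Ici 0) t
  continuousOn_dy : ContinuousOn dy (Set.Ici 0)
  hasDeriv_dy : ∀ k : ℕ, ∀ t ∈ Set.Ico ((k : ℝ) * h) (((k : ℝ) + 1) * h),
    HasDerivWithinAt dy
      (b * eventControl σ (sampledControl h q kp ki kd y) k - a₁ * dy t - a₂ * y t)
      (Set.Ico ((k : ℝ) * h) (((k : ℝ) + 1) * h)) t

/-- The integral state of the sampled-data controller:
`(t - t_k) y(t_k) + h ∑_{j=0}^{k-1} y(t_j)` for `t ∈ [t_k, t_{k+1})`. -/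
def sampledIntegral (h : ℝ) (y : ℝ → ℝ) (t : ℝ) : ℝ :=
  (t - (⌊t / h⌋₊ : ℝ) * h) * y ((⌊t / h⌋₊ : ℝ) * h)
    + h * ∑ j ∈ Finset.range ⌊t / h⌋₊, y ((j : ℝ) * h)

/-! ### Exponential stability -/

/-- `‖x(t)‖ ≤ M e^{-α t} ‖x(0)‖` for all `t ≥ 0`. -/
def DecaysExp {n : ℕ} (α M : ℝ) (x : ℝ → EuclideanSpace ℝ (Fin n)) : Prop :=
  ∀ t, 0 ≤ t → ‖x t‖ ≤ M * Real.exp (-α * t) * ‖x 0‖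

/-- The PID controller exponentially stabilizes the plant, with decay rate `α`: the plant state
`(y, y')` decays, with a constant independent of the solution. -/
def PIDStabilizes (a₁ a₂ b kp ki kd α : ℝ) : Prop :=
  ∃ M : ℝ, ∀ y dy : ℝ → ℝ, IsPIDSolution a₁ a₂ b kp ki kd y dy →
    DecaysExp α M (fun t => !₂[y t, dy t])

/-- As `PIDStabilizes`, for the state `(y, y', ∫₀ᵗ y)` of plant and controller together. -/
def PIDStabilizesFull (a₁ a₂ b kp ki kd α : ℝ) : Prop :=
  ∃ M : ℝ, ∀ y dy : ℝ → ℝ, IsPIDSolution a₁ a₂ b kp ki kd y dy →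
    DecaysExp α M (fun t => !₂[y t, dy t, ∫ s in (0 : ℝ)..t, y s])

/-- The event-triggered sampled-data PID controller exponentially stabilizes the plant, with
decay rate `α`: the plant state `(y, y')` decays, with a constant independent of the solution. -/
def EventStabilizes (a₁ a₂ b h : ℝ) (q : ℕ) (kp ki kd σ α : ℝ) : Prop :=
  ∃ M : ℝ, ∀ y dy : ℝ → ℝ, IsEventSolution a₁ a₂ b h q kp ki kd σ y dy →
    DecaysExp α M (fun t => !₂[y t, dy t])

/-- As `EventStabilizes`, for the state of plant and controller integral together. -/
def EventStabilizesFull (a₁ a₂ b h : ℝ) (q : ℕ) (kp ki kd σ α : ℝ) : Prop :=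
  ∃ M : ℝ, ∀ y dy : ℝ → ℝ, IsEventSolution a₁ a₂ b h q kp ki kd σ y dy →
    DecaysExp α M (fun t => !₂[y t, dy t, sampledIntegral h y t])

/-! ### The linear matrix inequality -/

/-- The matrix `A` of the closed loop. -/
def matA (a₁ a₂ b h : ℝ) (q : ℕ) (kp ki kd : ℝ) : Matrix (Fin 3) (Fin 3) ℝ :=
  !![0, 1, 0;
     -a₂ + b * (kp + kd), -a₁ - q * h * b * kd, b * ki;
     1, 0, 0]

/-- The matrix `A_v` of the closed loop. -/
def matAv (b kp ki : ℝ) : Matrix (Fin 3) (Fin 3) ℝ :=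
  !![0, 0, 0;
     b * kp, 0, b * ki;
     1, 0, 0]

/-- The column `B` of the closed loop. -/
def matB (b : ℝ) : Matrix (Fin 3) (Fin 1) ℝ := !![0; b; 0]

/-- The matrix with a one in the middle and zeros elsewhere. -/
def matE : Matrix (Fin 3) (Fin 3) ℝ := !![0, 0, 0; 0, 1, 0; 0, 0, 0]

/-- `G = h² e^{2αh} S + E R kd² (q h)²`. -/
def matG (h : ℝ) (q : ℕ) (kd α : ℝ) (S : Matrix (Fin 3) (Fin 3) ℝ) (R : ℝ) :
    Matrix (Fin 3) (Fin 3) ℝ :=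
  (h ^ 2 * Real.exp (2 * α * h)) • S + (R * kd ^ 2 * (q * h) ^ 2) • matE

/-- The index type of the seven blocks, of sizes `3, 3, 1, 1, 1, 1, 3`. -/
abbrev LMIIndex : Type := Fin 3 ⊕ Fin 3 ⊕ Fin 1 ⊕ Fin 1 ⊕ Fin 1 ⊕ Fin 1 ⊕ Fin 3

/-- The symmetric `7 × 7` block matrix `Ψ`, built from its blocks `Ψij` with `i ≤ j`; those that
are not listed in the `let`s are zero. -/
def matΨ (a₁ a₂ b h : ℝ) (q : ℕ) (kp ki kd σ α : ℝ)
    (P S : Matrix (Fin 3) (Fin 3) ℝ) (W R ω : ℝ) : Matrix LMIIndex LMIIndex ℝ :=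
  let A := matA a₁ a₂ b h q kp ki kd
  let Av := matAv b kp ki
  let B := matB b
  let G := matG h q kd α S R
  let Ψ11 : Matrix (Fin 3) (Fin 3) ℝ :=
    P * A + Aᵀ * P + (2 * α) • P + (W * kd ^ 2 * h ^ 2 * Real.exp (2 * α * h)) • matE
  let Ψ12 : Matrix (Fin 3) (Fin 3) ℝ := √h • (P * Av)
  let Ψ13 : Matrix (Fin 3) (Fin 1) ℝ := P * B
  let Ψ14 : Matrix (Fin 3) (Fin 1) ℝ := P * B
  let Ψ15 : Matrix (Fin 3) (Fin 1) ℝ := P * B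
  let Ψ16 : Matrix (Fin 3) (Fin 1) ℝ := (ω * σ) • !![kp + kd; -(q * h * kd); ki]
  let Ψ17 : Matrix (Fin 3) (Fin 3) ℝ := Aᵀ * G
  let Ψ22 : Matrix (Fin 3) (Fin 3) ℝ := (-(Real.pi ^ 2 / 4) * h) • S
  let Ψ26 : Matrix (Fin 3) (Fin 1) ℝ := (ω * σ * √h) • !![kp; 0; ki]
  let Ψ27 : Matrix (Fin 3) (Fin 3) ℝ := √h • (Avᵀ * G)
  let Ψ33 : Matrix (Fin 1) (Fin 1) ℝ :=
    !![-W * (Real.pi ^ 2 / 4) * Real.exp (-2 * α * q * h)]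
  let Ψ36 : Matrix (Fin 1) (Fin 1) ℝ := !![ω * σ]
  let Ψ37 : Matrix (Fin 1) (Fin 3) ℝ := Bᵀ * G
  let Ψ44 : Matrix (Fin 1) (Fin 1) ℝ :=
    !![-R * (4 / (q * h) ^ 2) * Real.exp (-2 * α * q * h)]
  let Ψ46 : Matrix (Fin 1) (Fin 1) ℝ := !![ω * σ]
  let Ψ47 : Matrix (Fin 1) (Fin 3) ℝ := Bᵀ * G
  let Ψ55 : Matrix (Fin 1) (Fin 1) ℝ := !![-ω]
  let Ψ57 : Matrix (Fin 1) (Fin 3) ℝ := Bᵀ * G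
  let Ψ66 : Matrix (Fin 1) (Fin 1) ℝ := !![-(ω * σ)]
  let Ψ77 : Matrix (Fin 3) (Fin 3) ℝ := -G
  -- the parts of the block rows strictly to the right of the diagonal
  let row1 : Matrix (Fin 3) (Fin 3 ⊕ Fin 1 ⊕ Fin 1 ⊕ Fin 1 ⊕ Fin 1 ⊕ Fin 3) ℝ :=
    .fromCols Ψ12 (.fromCols Ψ13 (.fromCols Ψ14 (.fromCols Ψ15 (.fromCols Ψ16 Ψ17))))
  let row2 : Matrix (Fin 3) (Fin 1 ⊕ Fin 1 ⊕ Fin 1 ⊕ Fin 1 ⊕ Fin 3) ℝ :=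
    .fromCols 0 (.fromCols 0 (.fromCols 0 (.fromCols Ψ26 Ψ27)))
  let row3 : Matrix (Fin 1) (Fin 1 ⊕ Fin 1 ⊕ Fin 1 ⊕ Fin 3) ℝ :=
    .fromCols 0 (.fromCols 0 (.fromCols Ψ36 Ψ37))
  let row4 : Matrix (Fin 1) (Fin 1 ⊕ Fin 1 ⊕ Fin 3) ℝ := .fromCols 0 (.fromCols Ψ46 Ψ47)
  let row5 : Matrix (Fin 1) (Fin 1 ⊕ Fin 3) ℝ := .fromCols 0 Ψ57
  let row6 : Matrix (Fin 1) (Fin 3) ℝ := 0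
  .fromBlocks Ψ11 row1 row1ᵀ <|
  .fromBlocks Ψ22 row2 row2ᵀ <|
  .fromBlocks Ψ33 row3 row3ᵀ <|
  .fromBlocks Ψ44 row4 row4ᵀ <|
  .fromBlocks Ψ55 row5 row5ᵀ <|
  .fromBlocks Ψ66 row6 row6ᵀ Ψ77

/-- Feasibility of the LMI: `Ψ ≤ 0` for some positive definite `P`, `S` and nonnegative `W`,
`R`, `ω`. -/
def LMIFeasible (a₁ a₂ b h : ℝ) (q : ℕ) (kp ki kd σ α : ℝ) : Prop :=
  ∃ (P S : Matrix (Fin 3) (Fin 3) ℝ) (W R ω : ℝ),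
    P.PosDef ∧ S.PosDef ∧ 0 ≤ W ∧ 0 ≤ R ∧ 0 ≤ ω ∧
      (-(matΨ a₁ a₂ b h q kp ki kd σ α P S W R ω)).PosSemidef

/-- The discrete delay `q = ⌊h^{-1/2}⌋`. -/
def delayOf (h : ℝ) : ℕ := ⌊h ^ (-(1 / 2) : ℝ)⌋₊

end PID

end

namespace PID

open Set Filter Topology MeasureTheory

section Basic

variable {a₁ a₂ b h kp ki kd σ : ℝ} {q : ℕ} {y dy : ℝ → ℝ}

/-! ### Measurable, locally bounded functions -/

/-- Measurable functions on the line that are bounded on bounded intervals. -/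
structure LocBdd (f : ℝ → ℝ) : Prop where
  measurable : Measurable f
  bdd : ∀ r s : ℝ, ∃ C, ∀ t ∈ Icc r s, |f t| ≤ C

theorem LocBdd.of_continuous {f : ℝ → ℝ} (hf : Continuous f) : LocBdd f where
  measurable := hf.measurable
  bdd r s := by
    obtain ⟨C, hC⟩ := (isCompact_Icc (a := r) (b := s)).exists_bound_of_continuousOn
      hf.continuousOn
    exact ⟨C, hC⟩

theorem LocBdd.const (c : ℝ) : LocBdd (fun _ => c) := .of_continuous continuous_const

theorem LocBdd.add {f g : ℝ → ℝ} (hf : LocBdd f) (hg : LocBdd g) :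
    LocBdd (fun t => f t + g t) where
  measurable := hf.measurable.add hg.measurable
  bdd r s := by
    obtain ⟨C, hC⟩ := hf.bdd r s
    obtain ⟨D, hD⟩ := hg.bdd r s
    exact ⟨C + D, fun t ht => (abs_add_le _ _).trans (add_le_add (hC t ht) (hD t ht))⟩

theorem LocBdd.mul {f g : ℝ → ℝ} (hf : LocBdd f) (hg : LocBdd g) :
    LocBdd (fun t => f t * g t) where
  measurable := hf.measurable.mul hg.measurable
  bdd r s := by
    obtain ⟨C, hC⟩ := hf.bdd r s
    obtain ⟨D, hD⟩ := hg.bdd r s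
    refine ⟨C * D, fun t ht => ?_⟩
    rw [abs_mul]
    exact mul_le_mul (hC t ht) (hD t ht) (abs_nonneg _) ((abs_nonneg _).trans (hC t ht))

theorem LocBdd.neg {f : ℝ → ℝ} (hf : LocBdd f) : LocBdd (fun t => -f t) := by
  simpa using (LocBdd.const (-1)).mul hf

theorem LocBdd.sub {f g : ℝ → ℝ} (hf : LocBdd f) (hg : LocBdd g) :
    LocBdd (fun t => f t - g t) := by
  simpa [sub_eq_add_neg] using hf.add hg.neg

theorem LocBdd.sq {f : ℝ → ℝ} (hf : LocBdd f) : LocBdd (fun t => f t ^ 2) := by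
  simpa [_root_.sq] using hf.mul hf

theorem LocBdd.sum {ι : Type*} (s : Finset ι) {f : ι → ℝ → ℝ} (hf : ∀ i, LocBdd (f i)) :
    LocBdd (fun t => ∑ i ∈ s, f i t) := by
  classical
  induction s using Finset.induction_on with
  | empty => simpa using LocBdd.const 0
  | insert a s ha ih => simpa [Finset.sum_insert ha] using (hf a).add ih

theorem LocBdd.comp_sub_const {f : ℝ → ℝ} (hf : LocBdd f) (c : ℝ) :
    LocBdd (fun t => f (t - c)) where
  measurable := hf.measurable.comp (measurable_id.sub_const c)
  bdd r s := by
    obtain ⟨C, hC⟩ := hf.bdd (r - c) (s - c)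
    exact ⟨C, fun t ht => hC _ ⟨by linarith [ht.1], by linarith [ht.2]⟩⟩

theorem LocBdd.intervalIntegrable {f : ℝ → ℝ} (hf : LocBdd f) (r s : ℝ) :
    IntervalIntegrable f volume r s := by
  obtain ⟨C, hC⟩ := hf.bdd (min r s) (max r s)
  rw [intervalIntegrable_iff]
  refine Measure.integrableOn_of_bounded (M := C) (by simp) hf.measurable.aestronglyMeasurable ?_
  refine (ae_restrict_iff' measurableSet_uIoc).2 (.of_forall fun t ht => ?_)
  exact hC t ⟨ht.1.le, ht.2⟩

/-- A step function on a grid of positive step. -/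
theorem LocBdd.step (hh : 0 < h) (c : ℕ → ℝ) : LocBdd (fun t => c ⌊t / h⌋₊) where
  measurable := (measurable_from_top (f := c)).comp
    (Nat.measurable_floor.comp (measurable_id.div_const h))
  bdd r s := by
    refine ⟨∑ k ∈ Finset.range (⌊s / h⌋₊ + 1), |c k|, fun t ht => ?_⟩
    refine Finset.single_le_sum (f := fun k => |c k|) (fun _ _ => abs_nonneg _) ?_
    rw [Finset.mem_range, Nat.lt_succ_iff]
    exact Nat.floor_mono (div_le_div_of_nonneg_right ht.2 hh.le)

/-! ### The sampling grid -/

theorem floor_div_eq (hh : 0 < h) {k : ℕ} {t : ℝ}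
    (ht : t ∈ Ico ((k : ℝ) * h) (((k : ℝ) + 1) * h)) : ⌊t / h⌋₊ = k := by
  have h0 : 0 ≤ t / h := div_nonneg (le_trans (by positivity) ht.1) hh.le
  exact (Nat.floor_eq_iff h0).2 ⟨(le_div_iff₀ hh).2 ht.1, (div_lt_iff₀ hh).2 ht.2⟩

theorem mem_grid (hh : 0 < h) {t : ℝ} (ht : 0 ≤ t) :
    t ∈ Ico ((⌊t / h⌋₊ : ℝ) * h) (((⌊t / h⌋₊ : ℝ) + 1) * h) :=
  ⟨(le_div_iff₀ hh).1 (Nat.floor_le (div_nonneg ht hh.le)),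
    (div_lt_iff₀ hh).1 (Nat.lt_floor_add_one _)⟩

theorem eventually_floor_eq (hh : 0 < h) {t : ℝ} (ht : 0 ≤ t) :
    ∀ᶠ s in 𝓝[≥] t, ⌊s / h⌋₊ = ⌊t / h⌋₊ := by
  have hm := mem_grid hh ht
  filter_upwards [Ico_mem_nhdsGE hm.2] with s hs
  exact floor_div_eq hh ⟨hm.1.trans hs.1, hs.2⟩

/-- The integral of a step function, up to time `T`. -/
theorem integral_step (hh : 0 < h) (c : ℕ → ℝ) {T : ℝ} (hT : 0 ≤ T) :
    ∫ s in (0 : ℝ)..T, c ⌊s / h⌋₊ =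
      (T - (⌊T / h⌋₊ : ℝ) * h) * c ⌊T / h⌋₊ + h * ∑ j ∈ Finset.range ⌊T / h⌋₊, c j := by
  have key : ∀ k : ℕ, ∀ t, (k : ℝ) * h ≤ t → t ≤ ((k : ℝ) + 1) * h →
      ∫ s in ((k : ℝ) * h)..t, c ⌊s / h⌋₊ = (t - k * h) * c k := by
    intro k t h1 h2
    have : ∫ s in ((k : ℝ) * h)..t, c ⌊s / h⌋₊ = ∫ s in ((k : ℝ) * h)..t, c k := by
      rw [intervalIntegral.integral_of_le h1, intervalIntegral.integral_of_le h1,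
        ← integral_Ico_eq_integral_Ioc, ← integral_Ico_eq_integral_Ioc]
      refine setIntegral_congr_fun measurableSet_Ico fun s hs => ?_
      simp only [floor_div_eq hh ⟨hs.1, hs.2.trans_le h2⟩]
    rw [this]; simp
  have int := (LocBdd.step hh c).intervalIntegrable
  have grid : ∀ n : ℕ, ∫ s in (0 : ℝ)..(n * h), c ⌊s / h⌋₊ = h * ∑ j ∈ Finset.range n, c j := by
    intro n
    induction n with
    | zero => simp
    | succ n ih =>
      rw [← intervalIntegral.integral_add_adjacent_intervals (int 0 (n * h)) (int _ _), ih,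
        key n _ (by push_cast; nlinarith) (by push_cast; rfl), Finset.sum_range_succ]
      push_cast; ring
  have hm := mem_grid hh hT
  rw [← intervalIntegral.integral_add_adjacent_intervals (int 0 (⌊T / h⌋₊ * h)) (int _ _), grid,
    key _ _ hm.1 hm.2.le]
  ring

theorem sampledIntegral_eq_integral (hh : 0 < h) (y : ℝ → ℝ) {T : ℝ} (hT : 0 ≤ T) :
    sampledIntegral h y T = ∫ s in (0 : ℝ)..T, y ((⌊s / h⌋₊ : ℝ) * h) :=
  (integral_step hh (fun k => y ((k : ℝ) * h)) hT).symm

theorem hasDerivWithinAt_sampledIntegral (hh : 0 < h) (y : ℝ → ℝ) {t : ℝ} (ht : 0 ≤ t) :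
    HasDerivWithinAt (sampledIntegral h y) (y ((⌊t / h⌋₊ : ℝ) * h)) (Ici t) t := by
  have h1 : HasDerivWithinAt (fun s => (s - (⌊t / h⌋₊ : ℝ) * h) * y ((⌊t / h⌋₊ : ℝ) * h)
      + h * ∑ j ∈ Finset.range ⌊t / h⌋₊, y ((j : ℝ) * h))
      (1 * y ((⌊t / h⌋₊ : ℝ) * h)) (Ici t) t :=
    (((hasDerivAt_id t).sub_const _).mul_const _ |>.add_const _).hasDerivWithinAt
  rw [one_mul] at h1
  refine h1.congr_of_eventuallyEq ?_ rfl
  filter_upwards [eventually_floor_eq hh ht] with s hs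
  simp only [sampledIntegral, hs]

theorem sampledIntegral_zero (h : ℝ) (y : ℝ → ℝ) : sampledIntegral h y 0 = 0 := by
  simp [sampledIntegral]

theorem sampledIntegral_grid (hh : 0 < h) (y : ℝ → ℝ) (k : ℕ) :
    sampledIntegral h y (k * h) = h * ∑ j ∈ Finset.range k, y ((j : ℝ) * h) := by
  have : ⌊(k : ℝ) * h / h⌋₊ = k := by rw [mul_div_cancel_right₀ _ hh.ne']; simp
  simp [sampledIntegral, this]

/-! ### The event-triggered control -/

theorem eventControl_sub_sq_le (hσ : 0 ≤ σ) (u : ℕ → ℝ) (k : ℕ) :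
    (eventControl σ u k - u k) ^ 2 ≤ σ * u k ^ 2 := by
  cases k with
  | zero => simp only [eventControl, sub_self]; nlinarith [sq_nonneg (u 0)]
  | succ k =>
    simp only [eventControl]
    split_ifs with h
    · rw [sub_self]; nlinarith [sq_nonneg (u (k + 1))]
    · nlinarith

theorem abs_eventControl_sub_le (hσ : 0 ≤ σ) (u : ℕ → ℝ) (k : ℕ) :
    |eventControl σ u k - u k| ≤ √σ * |u k| := by
  refine abs_le_of_sq_le_sq ?_ (by positivity)
  rw [mul_pow, Real.sq_sqrt hσ, sq_abs]
  exact eventControl_sub_sq_le hσ u k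

theorem abs_eventControl_le (hσ : 0 ≤ σ) (hσ1 : σ ≤ 1) (u : ℕ → ℝ) (k : ℕ) :
    |eventControl σ u k| ≤ 2 * |u k| := by
  have h1 := abs_eventControl_sub_le hσ u k
  have h2 : √σ ≤ 1 := Real.sqrt_le_one.2 hσ1
  have h3 : |eventControl σ u k| ≤ |eventControl σ u k - u k| + |u k| := by
    simpa using abs_add_le (eventControl σ u k - u k) (u k)
  nlinarith [abs_nonneg (u k)]

theorem sampledControl_congr (hh : 0 ≤ h) {y₁ y₂ : ℝ → ℝ} (hy : ∀ t, 0 ≤ t → y₁ t = y₂ t) :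
    sampledControl h q kp ki kd y₁ = sampledControl h q kp ki kd y₂ := by
  funext k
  have : ∀ j : ℕ, y₁ ((j : ℝ) * h) = y₂ ((j : ℝ) * h) := fun j => hy _ (by positivity)
  simp only [sampledControl, delayedSample, this]

/-! ### Solutions of the event-triggered closed loop -/

/-- The right second derivative of a solution. -/
noncomputable def eventAccel (a₁ a₂ b h : ℝ) (q : ℕ) (kp ki kd σ : ℝ) (y dy : ℝ → ℝ) (t : ℝ) : ℝ :=
  b * eventControl σ (sampledControl h q kp ki kd y) ⌊t / h⌋₊ - a₁ * dy t - a₂ * y t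

/-- The values at negative times of a solution do not matter. -/
theorem IsEventSolution.congr (hh : 0 < h) {y₂ dy₂ : ℝ → ℝ}
    (hs : IsEventSolution a₁ a₂ b h q kp ki kd σ y dy) (hy : ∀ t, 0 ≤ t → y₂ t = y t)
    (hdy : ∀ t, 0 ≤ t → dy₂ t = dy t) : IsEventSolution a₁ a₂ b h q kp ki kd σ y₂ dy₂ where
  hasDeriv_y t ht := by
    rw [hdy t ht]
    exact (hs.hasDeriv_y t ht).congr (fun s hs => hy s hs) (hy t ht)
  continuousOn_dy := hs.continuousOn_dy.congr fun t ht => hdy t ht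
  hasDeriv_dy k t ht := by
    have h0 : ∀ s ∈ Ico ((k : ℝ) * h) (((k : ℝ) + 1) * h), 0 ≤ s := fun s hs =>
      le_trans (by positivity) hs.1
    rw [sampledControl_congr hh.le hy, hdy t (h0 t ht), hy t (h0 t ht)]
    exact (hs.hasDeriv_dy k t ht).congr (fun s hs => hdy s (h0 s hs)) (hdy t (h0 t ht))

theorem IsEventSolution.hasDeriv_y_right (hs : IsEventSolution a₁ a₂ b h q kp ki kd σ y dy)
    {t : ℝ} (ht : 0 ≤ t) : HasDerivWithinAt y (dy t) (Ici t) t :=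
  (hs.hasDeriv_y t ht).mono (Ici_subset_Ici.2 ht)

theorem IsEventSolution.hasDeriv_dy_right (hh : 0 < h)
    (hs : IsEventSolution a₁ a₂ b h q kp ki kd σ y dy) {t : ℝ} (ht : 0 ≤ t) :
    HasDerivWithinAt dy (eventAccel a₁ a₂ b h q kp ki kd σ y dy t) (Ici t) t := by
  have hm := mem_grid hh ht
  refine (hs.hasDeriv_dy _ t hm).mono_of_mem_nhdsWithin ?_
  filter_upwards [Ico_mem_nhdsGE hm.2] with s hs
  exact ⟨hm.1.trans hs.1, hs.2⟩

theorem IsEventSolution.continuousOn_y (hs : IsEventSolution a₁ a₂ b h q kp ki kd σ y dy) :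
    ContinuousOn y (Ici 0) := fun t ht => (hs.hasDeriv_y t ht).continuousWithinAt

theorem locBdd_eventAccel (hh : 0 < h) (hy : Continuous y) (hdy : Continuous dy) :
    LocBdd (eventAccel a₁ a₂ b h q kp ki kd σ y dy) :=
  (((LocBdd.const b).mul (LocBdd.step hh _)).sub (.of_continuous (hdy.const_mul a₁))).sub
    (.of_continuous (hy.const_mul a₂))

theorem abs_sampledControl_le (hh : 0 ≤ h) {C : ℝ} (N : ℕ)
    (hC : ∀ t, 0 ≤ t → t ≤ N * h → |y t| ≤ C) :
    |sampledControl h q kp ki kd y N| ≤ (|kp| + |ki| * h * N + |kd|) * C := by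
  have hgrid : ∀ j : ℕ, j ≤ N → |y ((j : ℝ) * h)| ≤ C := fun j hj =>
    hC _ (by positivity) (mul_le_mul_of_nonneg_right (by exact_mod_cast hj) hh)
  have hC0 : 0 ≤ C := (abs_nonneg _).trans (hgrid 0 (Nat.zero_le _))
  have h1 : |∑ j ∈ Finset.range N, y ((j : ℝ) * h)| ≤ N * C := by
    refine (Finset.abs_sum_le_sum_abs _ _).trans ?_
    refine (Finset.sum_le_card_nsmul _ _ C fun j hj => hgrid j (Finset.mem_range.1 hj).le).trans ?_
    simp
  have h2 : |delayedSample h q y N| ≤ C := by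
    unfold delayedSample
    split_ifs
    · simpa using hC0
    · exact hgrid _ (Nat.sub_le _ _)
  unfold sampledControl
  refine (abs_add_le _ _).trans ?_
  refine (add_le_add_left (abs_add_le _ _) _).trans ?_
  rw [abs_mul, abs_mul, abs_mul, abs_mul, abs_of_nonneg hh]
  have h3 := mul_le_mul_of_nonneg_left (hgrid N le_rfl) (abs_nonneg kp)
  have h4 := mul_le_mul_of_nonneg_left h1 (show 0 ≤ |ki| * h by positivity)
  have h5 := mul_le_mul_of_nonneg_left h2 (abs_nonneg kd)
  linarith

/-- On bounded time intervals, solutions are bounded in terms of their initial state. -/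
theorem exists_growth_bound (a₁ a₂ b : ℝ) (hh : 0 < h) (q : ℕ) (kp ki kd : ℝ) (hσ : 0 ≤ σ)
    (hσ1 : σ ≤ 1) (N : ℕ) : ∃ C, 0 ≤ C ∧ ∀ y dy : ℝ → ℝ,
      IsEventSolution a₁ a₂ b h q kp ki kd σ y dy → ∀ t, 0 ≤ t → t ≤ N * h →
        |y t| ≤ C * (|y 0| + |dy 0|) ∧ |dy t| ≤ C * (|y 0| + |dy 0|) := by
  induction N with
  | zero =>
    refine ⟨1, zero_le_one, fun y dy _ t h0 h1 => ?_⟩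
    have : t = 0 := le_antisymm (by simpa using h1) h0
    subst this
    constructor <;> linarith [abs_nonneg (y 0), abs_nonneg (dy 0)]
  | succ N ih =>
    obtain ⟨C, hC0, hC⟩ := ih
    set K : ℝ := 1 + |a₁| + |a₂| with hK
    have hK1 : 0 < K := by positivity
    set U : ℝ := (|kp| + |ki| * h * N + |kd|) * C with hU
    have hU0 : 0 ≤ U := by positivity
    set D : ℝ := (C + |b| * (2 * U) / K) * Real.exp (K * h) with hD
    have hCD : C ≤ D := by
      have h1 : 1 ≤ Real.exp (K * h) := Real.one_le_exp (by positivity)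
      have h2 : 0 ≤ |b| * (2 * U) / K := by positivity
      nlinarith
    refine ⟨D, hC0.trans hCD, fun y dy hs t h0 h1 => ?_⟩
    set r := |y 0| + |dy 0| with hr
    have hr0 : 0 ≤ r := by positivity
    rcases le_total t (N * h) with ht | ht
    · have := hC y dy hs t h0 ht
      have h3 : C * r ≤ D * r := mul_le_mul_of_nonneg_right hCD hr0
      exact ⟨this.1.trans h3, this.2.trans h3⟩
    have hN0 : (0 : ℝ) ≤ N * h := by positivity
    have hu : |sampledControl h q kp ki kd y N| ≤ U * r := by
      have := abs_sampledControl_le (q := q) (kp := kp) (ki := ki) (kd := kd) (y := y) hh.le N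
        (C := C * r) fun t h0 h1 => (hC y dy hs t h0 h1).1
      rw [hU]; linarith
    have hg := norm_le_gronwallBound_of_norm_deriv_right_le (f := fun t => (y t, dy t))
      (f' := fun t => (dy t, eventAccel a₁ a₂ b h q kp ki kd σ y dy t)) (δ := C * r) (K := K)
      (ε := |b| * (2 * (U * r))) (a := N * h) (b := t) ?_ ?_ ?_ ?_ t ⟨ht, le_rfl⟩
    · have hb : gronwallBound (C * r) K (|b| * (2 * (U * r))) (t - N * h) ≤ D * r := by
        rw [gronwallBound_of_K_ne_0 hK1.ne']
        simp only
        have e1 : Real.exp (K * (t - N * h)) ≤ Real.exp (K * h) := by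
          apply Real.exp_le_exp.2
          apply mul_le_mul_of_nonneg_left _ hK1.le
          push_cast at h1; linarith
        have e2 : 0 ≤ |b| * (2 * (U * r)) / K := by positivity
        have e3 : D * r = C * r * Real.exp (K * h)
            + |b| * (2 * (U * r)) / K * Real.exp (K * h) := by rw [hD]; ring
        rw [e3]
        have e4 : 0 ≤ C * r := by positivity
        nlinarith [mul_le_mul_of_nonneg_left e1 e4, mul_le_mul_of_nonneg_left e1 e2]
      have hg' := hg.trans hb
      exact ⟨(norm_fst_le (y t, dy t)).trans hg', (norm_snd_le (y t, dy t)).trans hg'⟩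
    · have hsub : Icc ((N : ℝ) * h) t ⊆ Ici 0 := fun s hs => hN0.trans hs.1
      exact (hs.continuousOn_y.mono hsub).prodMk (hs.continuousOn_dy.mono hsub)
    · intro s hs'
      have h0 : 0 ≤ s := hN0.trans hs'.1
      exact (hs.hasDeriv_y_right h0).prodMk (hs.hasDeriv_dy_right hh h0)
    · have := hC y dy hs (N * h) hN0 le_rfl
      exact max_le this.1 this.2
    · intro s hs'
      have hfl : ⌊s / h⌋₊ = N :=
        floor_div_eq hh ⟨hs'.1, hs'.2.trans_le (by push_cast at h1; exact h1)⟩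
      have hy : |y s| ≤ ‖(y s, dy s)‖ := norm_fst_le (y s, dy s)
      have hdy : |dy s| ≤ ‖(y s, dy s)‖ := norm_snd_le (y s, dy s)
      have hn := norm_nonneg (y s, dy s)
      set n := ‖(y s, dy s)‖
      have hacc : |eventAccel a₁ a₂ b h q kp ki kd σ y dy s| ≤
          |b| * (2 * (U * r)) + |a₁| * |dy s| + |a₂| * |y s| := by
        unfold eventAccel
        rw [hfl]
        refine (abs_sub _ _).trans (add_le_add ((abs_sub _ _).trans (add_le_add ?_ ?_)) ?_)
        · rw [abs_mul]
          refine mul_le_mul_of_nonneg_left ?_ (abs_nonneg _)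
          exact (abs_eventControl_le hσ hσ1 _ _).trans (by linarith)
        · rw [abs_mul]
        · rw [abs_mul]
      have hp : 0 ≤ |b| * (2 * (U * r)) := by positivity
      have ha1 := mul_le_mul_of_nonneg_left hdy (abs_nonneg a₁)
      have ha2 := mul_le_mul_of_nonneg_left hy (abs_nonneg a₂)
      have hq1 : 0 ≤ |a₁| * n := by positivity
      have hq2 : 0 ≤ |a₂| * n := by positivity
      refine max_le ?_ ?_
      · change |dy s| ≤ _
        rw [hK]; linarith
      · change |eventAccel a₁ a₂ b h q kp ki kd σ y dy s| ≤ _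
        rw [hK]; linarith

/-! ### Criteria for stability -/

theorem abs_apply_le_norm {n : ℕ} (x : EuclideanSpace ℝ (Fin n)) (i : Fin n) : |x i| ≤ ‖x‖ :=
  PiLp.norm_apply_le x i

theorem norm_vec2_le (r s : ℝ) : ‖(!₂[r, s] : EuclideanSpace ℝ (Fin 2))‖ ≤ |r| + |s| := by
  rw [EuclideanSpace.norm_eq, Real.sqrt_le_iff]
  refine ⟨by positivity, ?_⟩
  simp only [Fin.sum_univ_two, Real.norm_eq_abs]
  have := mul_nonneg (abs_nonneg r) (abs_nonneg s)
  simp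
  nlinarith [sq_abs r, sq_abs s]

theorem norm_vec3_le (r s t : ℝ) :
    ‖(!₂[r, s, t] : EuclideanSpace ℝ (Fin 3))‖ ≤ |r| + |s| + |t| := by
  rw [EuclideanSpace.norm_eq, Real.sqrt_le_iff]
  refine ⟨by positivity, ?_⟩
  simp only [Fin.sum_univ_three, Real.norm_eq_abs]
  have h1 := mul_nonneg (abs_nonneg r) (abs_nonneg s)
  have h2 := mul_nonneg (abs_nonneg r) (abs_nonneg t)
  have h3 := mul_nonneg (abs_nonneg s) (abs_nonneg t)
  simp
  nlinarith [sq_abs r, sq_abs s, sq_abs t]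

/-- To prove stability it is enough to bound the coordinates of continuous solutions. -/
theorem eventStabilizesFull_of_bound (hh : 0 < h) {α M : ℝ}
    (H : ∀ y dy : ℝ → ℝ, Continuous y → Continuous dy →
      IsEventSolution a₁ a₂ b h q kp ki kd σ y dy → ∀ t, 0 ≤ t →
        |y t| ≤ M * Real.exp (-α * t) * (|y 0| + |dy 0|) ∧
        |dy t| ≤ M * Real.exp (-α * t) * (|y 0| + |dy 0|) ∧
        |sampledIntegral h y t| ≤ M * Real.exp (-α * t) * (|y 0| + |dy 0|)) :
    EventStabilizesFull a₁ a₂ b h q kp ki kd σ α := by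
  refine ⟨|M| * 6, fun y dy hs t ht => ?_⟩
  have hmax : ∀ t : ℝ, 0 ≤ t → max t 0 = t := fun t ht => max_eq_left ht
  have hc : Continuous fun t : ℝ => max t 0 := continuous_id.max continuous_const
  have hs' := hs.congr hh (y₂ := fun t => y (max t 0)) (dy₂ := fun t => dy (max t 0))
    (fun t ht => by simp only [hmax t ht]) (fun t ht => by simp only [hmax t ht])
  obtain ⟨h1, h2, h3⟩ := H (fun t => y (max t 0)) (fun t => dy (max t 0))
    (hs.continuousOn_y.comp_continuous hc fun t => le_max_right t 0)
    (hs.continuousOn_dy.comp_continuous hc fun t => le_max_right t 0) hs' t ht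
  have hI : sampledIntegral h (fun t => y (max t 0)) t = sampledIntegral h y t := by
    have : ∀ j : ℕ, max ((j : ℝ) * h) 0 = j * h := fun j => hmax _ (by positivity)
    simp only [sampledIntegral, this]
  simp only [hI, hmax t ht, max_self] at h1 h2 h3
  have b1 := abs_apply_le_norm !₂[y 0, dy 0, sampledIntegral h y 0] 0
  have b2 := abs_apply_le_norm !₂[y 0, dy 0, sampledIntegral h y 0] 1
  simp only [Matrix.cons_val_zero, Matrix.cons_val_one] at b1 b2
  refine (norm_vec3_le _ _ _).trans ?_
  set r := ‖(!₂[y 0, dy 0, sampledIntegral h y 0] : EuclideanSpace ℝ (Fin 3))‖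
  have he : 0 < Real.exp (-α * t) := Real.exp_pos _
  have hb : M * Real.exp (-α * t) * (|y 0| + |dy 0|) ≤ |M| * Real.exp (-α * t) * (2 * r) := by
    refine mul_le_mul (mul_le_mul_of_nonneg_right (le_abs_self M) he.le) (by linarith)
      (by positivity) (by positivity)
  linarith

/-- The analogue of `eventStabilizesFull_of_bound` without the integral state. -/
theorem eventStabilizes_of_bound {α M : ℝ}
    (H : ∀ y dy : ℝ → ℝ, IsEventSolution a₁ a₂ b h q kp ki kd σ y dy → ∀ t, 0 ≤ t →
        |y t| ≤ M * Real.exp (-α * t) * (|y 0| + |dy 0|) ∧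
        |dy t| ≤ M * Real.exp (-α * t) * (|y 0| + |dy 0|)) :
    EventStabilizes a₁ a₂ b h q kp ki kd σ α := by
  refine ⟨|M| * 4, fun y dy hs t ht => ?_⟩
  obtain ⟨h1, h2⟩ := H _ _ hs t ht
  have b1 := abs_apply_le_norm !₂[y 0, dy 0] 0
  have b2 := abs_apply_le_norm !₂[y 0, dy 0] 1
  simp only [Matrix.cons_val_zero, Matrix.cons_val_one] at b1 b2
  refine (norm_vec2_le _ _).trans ?_
  set r := ‖(!₂[y 0, dy 0] : EuclideanSpace ℝ (Fin 2))‖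
  have he : 0 < Real.exp (-α * t) := Real.exp_pos _
  have hb : M * Real.exp (-α * t) * (|y 0| + |dy 0|) ≤ |M| * Real.exp (-α * t) * (2 * r) := by
    refine mul_le_mul (mul_le_mul_of_nonneg_right (le_abs_self M) he.le) (by linarith)
      (by positivity) (by positivity)
  linarith

theorem EventStabilizesFull.eventStabilizes {α : ℝ}
    (H : EventStabilizesFull a₁ a₂ b h q kp ki kd σ α) :
    EventStabilizes a₁ a₂ b h q kp ki kd σ α := by
  obtain ⟨M, hM⟩ := H
  refine eventStabilizes_of_bound (M := |M|) fun y dy hs t ht => ?_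
  have h0 := norm_vec3_le (y 0) (dy 0) (sampledIntegral h y 0)
  rw [sampledIntegral_zero, abs_zero, add_zero] at h0
  have h1 := hM y dy hs t ht
  simp only [sampledIntegral_zero] at h1
  have b1 := abs_apply_le_norm !₂[y t, dy t, sampledIntegral h y t] 0
  have b2 := abs_apply_le_norm !₂[y t, dy t, sampledIntegral h y t] 1
  simp only [Matrix.cons_val_zero, Matrix.cons_val_one] at b1 b2
  have he : 0 < Real.exp (-α * t) := Real.exp_pos _
  have hb := h1.trans (mul_le_mul (mul_le_mul_of_nonneg_right (le_abs_self M) he.le) h0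
    (norm_nonneg _) (by positivity))
  exact ⟨b1.trans hb, b2.trans hb⟩

end Basic

section Inequalities

/-! ### Wirtinger's inequality -/

theorem wirtinger_of_lt {f g : ℝ → ℝ} {r s c : ℝ} (hrs : r ≤ s) (hf : Continuous f)
    (hg : LocBdd g) (hd : ∀ t ∈ Ioo r s, HasDerivWithinAt f (g t) (Ioi t) t) (hr : f r = 0)
    (hc : 0 ≤ c) (hcs : c * (s - r) < Real.pi / 2) :
    c ^ 2 * ∫ t in r..s, f t ^ 2 ≤ ∫ t in r..s, g t ^ 2 := by
  have hcos : ∀ t ∈ Icc r s, Real.cos (c * (s - t)) ≠ 0 := by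
    intro t ht
    have h1 : 0 ≤ c * (s - t) := mul_nonneg hc (by linarith [ht.2])
    have h2 : c * (s - t) ≤ c * (s - r) := mul_le_mul_of_nonneg_left (by linarith [ht.1]) hc
    exact (Real.cos_pos_of_mem_Ioo ⟨by linarith [Real.pi_pos], by linarith⟩).ne'
  have hφ : LocBdd fun t => g t ^ 2 - c ^ 2 * f t ^ 2 :=
    hg.sq.sub ((LocBdd.const _).mul (LocBdd.of_continuous hf).sq)
  have key := intervalIntegral.sub_le_integral_of_hasDeriv_right_of_le
    (g := fun t => c * Real.tan (c * (s - t)) * f t ^ 2)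
    (g' := fun t => c * (1 / Real.cos (c * (s - t)) ^ 2 * (c * -1)) * f t ^ 2 +
      c * Real.tan (c * (s - t)) * (2 * f t * g t))
    (φ := fun t => g t ^ 2 - c ^ 2 * f t ^ 2) hrs ?_ ?_ ?_ ?_
  · simp only [hr, sub_self, mul_zero, Real.tan_zero, zero_mul, ne_eq, OfNat.ofNat_ne_zero,
      not_false_eq_true, zero_pow] at key
    rw [intervalIntegral.integral_sub (hg.sq.intervalIntegrable _ _)
      (((LocBdd.const _).mul (LocBdd.of_continuous hf).sq).intervalIntegrable _ _),
      intervalIntegral.integral_const_mul] at key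
    linarith
  · refine ContinuousOn.mul (continuousOn_const.mul ?_) (hf.pow 2).continuousOn
    intro t ht
    have := (Real.continuousAt_tan.2 (hcos t ht))
    exact (ContinuousAt.comp (f := fun t => c * (s - t)) this (by fun_prop)).continuousWithinAt
  · intro t ht
    have h1 : HasDerivAt (fun t => c * (s - t)) (c * -1) t :=
      ((hasDerivAt_id t).const_sub s).const_mul c
    have h2 := ((Real.hasDerivAt_tan (hcos t (Ioo_subset_Icc_self ht))).comp t h1).const_mul c
    have h3 := h2.hasDerivWithinAt.mul ((hd t ht).pow 2) (s := Ioi t)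
    refine h3.congr_deriv ?_
    simp
  · exact (intervalIntegrable_iff_integrableOn_Icc_of_le hrs).1 (hφ.intervalIntegrable r s)
  · intro t ht
    have h0 := hcos t (Ioo_subset_Icc_self ht)
    have h1 : 1 / Real.cos (c * (s - t)) ^ 2 = 1 + Real.tan (c * (s - t)) ^ 2 := by
      rw [← Real.inv_one_add_tan_sq h0, one_div, inv_inv]
    simp only [h1]
    nlinarith [sq_nonneg (g t - c * Real.tan (c * (s - t)) * f t)]

/-- **Wirtinger's inequality** for functions that vanish at the left end of the interval. -/
theorem wirtinger {f g : ℝ → ℝ} {r s h : ℝ} (hh : 0 < h) (hrs : r ≤ s) (hsh : s - r ≤ h)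
    (hf : Continuous f) (hg : LocBdd g)
    (hd : ∀ t ∈ Ioo r s, HasDerivWithinAt f (g t) (Ioi t) t) (hr : f r = 0) :
    Real.pi ^ 2 / 4 * ∫ t in r..s, f t ^ 2 ≤ h ^ 2 * ∫ t in r..s, g t ^ 2 := by
  have hlim : Tendsto (fun θ : ℝ => θ ^ 2 * (Real.pi ^ 2 / 4 * ∫ t in r..s, f t ^ 2)) (𝓝[<] 1)
      (𝓝 (1 ^ 2 * (Real.pi ^ 2 / 4 * ∫ t in r..s, f t ^ 2))) :=
    ((by fun_prop : Continuous fun θ : ℝ =>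
      θ ^ 2 * (Real.pi ^ 2 / 4 * ∫ t in r..s, f t ^ 2)).tendsto 1).mono_left nhdsWithin_le_nhds
  rw [one_pow, one_mul] at hlim
  refine le_of_tendsto hlim ?_
  filter_upwards [Ioo_mem_nhdsLT (zero_lt_one (α := ℝ))] with θ hθ
  have hpi := Real.pi_pos
  have hlt : θ * Real.pi / (2 * h) * (s - r) < Real.pi / 2 := by
    have h1 : θ * Real.pi / (2 * h) * (s - r) ≤ θ * Real.pi / (2 * h) * h :=
      mul_le_mul_of_nonneg_left hsh (div_nonneg (mul_nonneg hθ.1.le hpi.le) (by positivity))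
    have h2 : θ * Real.pi / (2 * h) * h = θ * (Real.pi / 2) := by field_simp
    nlinarith [hθ.2]
  have key := wirtinger_of_lt hrs hf hg hd hr
    (div_nonneg (mul_nonneg hθ.1.le hpi.le) (by positivity)) hlt
  have h3 := mul_le_mul_of_nonneg_left key (sq_nonneg h)
  refine le_trans (le_of_eq ?_) h3
  field_simp
  ring

/-- The weighted Wirtinger inequality for the error of sampling on a grid. -/
theorem integral_sampling_error_le {f g : ℝ → ℝ} {h α : ℝ} (hh : 0 < h) (hα : 0 ≤ α)
    (hf : Continuous f) (hg : LocBdd g)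
    (hd : ∀ t, 0 ≤ t → HasDerivWithinAt f (g t) (Ici t) t) (m : ℕ) {T : ℝ} (hT : m * h ≤ T) :
    Real.pi ^ 2 / 4 *
        ∫ t in (m * h)..T, Real.exp (2 * α * t) * (f t - f ((⌊t / h⌋₊ : ℝ) * h)) ^ 2 ≤
      h ^ 2 * Real.exp (2 * α * h) * ∫ t in (m * h)..T, Real.exp (2 * α * t) * g t ^ 2 := by
  have hexp : LocBdd fun t => Real.exp (2 * α * t) := .of_continuous (by fun_prop)
  have hL : LocBdd fun t => Real.exp (2 * α * t) * (f t - f ((⌊t / h⌋₊ : ℝ) * h)) ^ 2 :=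
    hexp.mul ((LocBdd.of_continuous hf).sub (LocBdd.step hh fun k => f ((k : ℝ) * h))).sq
  have hR : LocBdd fun t => Real.exp (2 * α * t) * g t ^ 2 := hexp.mul hg.sq
  have piece : ∀ (k : ℕ) (s : ℝ), (k : ℝ) * h ≤ s → s ≤ ((k : ℝ) + 1) * h →
      Real.pi ^ 2 / 4 *
        ∫ t in (k * h)..s, Real.exp (2 * α * t) * (f t - f ((⌊t / h⌋₊ : ℝ) * h)) ^ 2 ≤
      h ^ 2 * Real.exp (2 * α * h) * ∫ t in (k * h)..s, Real.exp (2 * α * t) * g t ^ 2 := by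
    intro k s h1 h2
    have hk0 : (0 : ℝ) ≤ k * h := by positivity
    have hfk : Continuous fun t => f t - f (k * h) := by fun_prop
    have hw := wirtinger (f := fun t => f t - f (k * h)) hh h1 (by linarith) hfk hg
      (fun t ht => ((hd t (hk0.trans ht.1.le)).mono Ioi_subset_Ici_self).sub_const _)
      (sub_self _)
    have i1 : ∫ t in (k * h)..s, Real.exp (2 * α * t) * (f t - f ((⌊t / h⌋₊ : ℝ) * h)) ^ 2 ≤
        ∫ t in (k * h)..s, Real.exp (2 * α * (k * h)) * Real.exp (2 * α * h) *
          (f t - f (k * h)) ^ 2 := by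
      refine intervalIntegral.integral_mono_on_of_le_Ioo h1 (hL.intervalIntegrable _ _)
        (((LocBdd.const _).mul (LocBdd.of_continuous hfk).sq).intervalIntegrable _ _) ?_
      intro t ht
      rw [floor_div_eq hh ⟨ht.1.le, ht.2.trans_le h2⟩]
      refine mul_le_mul_of_nonneg_right ?_ (sq_nonneg _)
      rw [← Real.exp_add]
      exact Real.exp_le_exp.2 (by nlinarith [ht.2])
    have i2 : ∫ t in (k * h)..s, Real.exp (2 * α * (k * h)) * g t ^ 2 ≤
        ∫ t in (k * h)..s, Real.exp (2 * α * t) * g t ^ 2 := by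
      refine intervalIntegral.integral_mono_on h1
        (((LocBdd.const _).mul hg.sq).intervalIntegrable _ _) (hR.intervalIntegrable _ _) ?_
      intro t ht
      refine mul_le_mul_of_nonneg_right ?_ (sq_nonneg _)
      exact Real.exp_le_exp.2 (mul_le_mul_of_nonneg_left ht.1 (by positivity))
    rw [intervalIntegral.integral_const_mul] at i1 i2
    have e0 := Real.exp_pos (2 * α * (k * h))
    have e1 := Real.exp_pos (2 * α * h)
    calc _ ≤ Real.pi ^ 2 / 4 * (Real.exp (2 * α * (k * h)) * Real.exp (2 * α * h) *
          ∫ t in (k * h)..s, (f t - f (k * h)) ^ 2) :=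
          mul_le_mul_of_nonneg_left i1 (by positivity)
      _ = Real.exp (2 * α * (k * h)) * Real.exp (2 * α * h) * (Real.pi ^ 2 / 4 *
          ∫ t in (k * h)..s, (f t - f (k * h)) ^ 2) := by ring
      _ ≤ Real.exp (2 * α * (k * h)) * Real.exp (2 * α * h) *
          (h ^ 2 * ∫ t in (k * h)..s, g t ^ 2) := mul_le_mul_of_nonneg_left hw (by positivity)
      _ = h ^ 2 * Real.exp (2 * α * h) * (Real.exp (2 * α * (k * h)) *
          ∫ t in (k * h)..s, g t ^ 2) := by ring
      _ ≤ _ := mul_le_mul_of_nonneg_left i2 (by positivity)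
  have grid : ∀ n : ℕ, m ≤ n → Real.pi ^ 2 / 4 *
        ∫ t in (m * h)..(n * h), Real.exp (2 * α * t) * (f t - f ((⌊t / h⌋₊ : ℝ) * h)) ^ 2 ≤
      h ^ 2 * Real.exp (2 * α * h) *
        ∫ t in (m * h)..(n * h), Real.exp (2 * α * t) * g t ^ 2 := by
    intro n hn
    induction n, hn using Nat.le_induction with
    | base => simp
    | succ n hn ih =>
      rw [← intervalIntegral.integral_add_adjacent_intervals
          (hL.intervalIntegrable (m * h) (n * h)) (hL.intervalIntegrable _ _),
        ← intervalIntegral.integral_add_adjacent_intervals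
          (hR.intervalIntegrable (m * h) (n * h)) (hR.intervalIntegrable _ _)]
      have := piece n (((n + 1 : ℕ) : ℝ) * h) (by push_cast; nlinarith) (by push_cast; rfl)
      linarith
  have hT0 : 0 ≤ T := le_trans (by positivity) hT
  have hm := mem_grid hh hT0
  rw [← intervalIntegral.integral_add_adjacent_intervals
      (hL.intervalIntegrable (m * h) ((⌊T / h⌋₊ : ℝ) * h)) (hL.intervalIntegrable _ _),
    ← intervalIntegral.integral_add_adjacent_intervals
      (hR.intervalIntegrable (m * h) ((⌊T / h⌋₊ : ℝ) * h)) (hR.intervalIntegrable _ _)]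
  have h1 := grid ⌊T / h⌋₊ (Nat.le_floor ((le_div_iff₀ hh).2 hT))
  have h2 := piece ⌊T / h⌋₊ T hm.1 hm.2.le
  linarith

/-! ### The error of replacing the derivative by a finite difference -/

theorem integral_ramp (τ : ℝ) : ∫ p in (0 : ℝ)..τ, (τ - p) = τ ^ 2 / 2 := by
  rw [intervalIntegral.integral_sub (by simp) (by simp)]
  simp
  ring

theorem difference_error_sq_le {y dy g : ℝ → ℝ} {τ t : ℝ} (hτ : 0 < τ) (ht : τ ≤ t)
    (hy : Continuous y) (hdy : Continuous dy) (hg : LocBdd g)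
    (hd : ∀ t, 0 ≤ t → HasDerivWithinAt y (dy t) (Ici t) t)
    (hdd : ∀ t, 0 ≤ t → HasDerivWithinAt dy (g t) (Ici t) t) :
    2 / τ ^ 2 * (y (t - τ) - y t + τ * dy t) ^ 2 ≤
      ∫ p in (0 : ℝ)..τ, (τ - p) * g (t - p) ^ 2 := by
  have hw : LocBdd fun r => r - (t - τ) := .of_continuous (by fun_prop)
  have hwg := hw.mul hg
  have hwg2 := hw.mul hg.sq
  set κ := y (t - τ) - y t + τ * dy t with hκ
  have h1 : ∫ r in (t - τ)..t, (r - (t - τ)) * g r = κ := by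
    have := intervalIntegral.integral_eq_sub_of_hasDeriv_right_of_le
      (f := fun r => (r - (t - τ)) * dy r - y r) (f' := fun r => (r - (t - τ)) * g r)
      (by linarith : t - τ ≤ t) (by fun_prop) ?_ (hwg.intervalIntegrable _ _)
    · rw [this, hκ]; ring
    · intro r hr
      have h0 : 0 ≤ r := by linarith [hr.1]
      have h2 := (((hasDerivAt_id r).sub_const (t - τ)).hasDerivWithinAt (s := Ici r)).mul
        (hdd r h0) |>.sub (hd r h0)
      refine (h2.mono Ioi_subset_Ici_self).congr_deriv ?_
      simp
  have h2 : ∫ r in (t - τ)..t, (r - (t - τ)) * g r ^ 2 =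
      ∫ p in (0 : ℝ)..τ, (τ - p) * g (t - p) ^ 2 := by
    have := intervalIntegral.integral_comp_sub_left (a := 0) (b := τ)
      (fun r => (r - (t - τ)) * g r ^ 2) t
    rw [sub_zero] at this
    rw [← this]
    refine intervalIntegral.integral_congr fun p _ => ?_
    ring
  have h3 : ∫ r in (t - τ)..t, (r - (t - τ)) = τ ^ 2 / 2 := by
    have := intervalIntegral.integral_comp_sub_left (a := 0) (b := τ)
      (fun r => r - (t - τ)) t
    rw [sub_zero] at this
    rw [← this, ← integral_ramp]
    refine intervalIntegral.integral_congr fun p _ => ?_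
    ring
  have h4 : 0 ≤ ∫ r in (t - τ)..t, (r - (t - τ)) * (g r - 2 * κ / τ ^ 2) ^ 2 := by
    refine intervalIntegral.integral_nonneg (by linarith) fun r hr => ?_
    exact mul_nonneg (by linarith [hr.1]) (sq_nonneg _)
  have h5 : ∫ r in (t - τ)..t, (r - (t - τ)) * (g r - 2 * κ / τ ^ 2) ^ 2 =
      (∫ r in (t - τ)..t, (r - (t - τ)) * g r ^ 2)
        - (2 * (2 * κ / τ ^ 2)) * (∫ r in (t - τ)..t, (r - (t - τ)) * g r)
        + (2 * κ / τ ^ 2) ^ 2 * ∫ r in (t - τ)..t, (r - (t - τ)) := by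
    rw [← intervalIntegral.integral_const_mul, ← intervalIntegral.integral_const_mul,
      ← intervalIntegral.integral_sub (hwg2.intervalIntegrable _ _)
        (((LocBdd.const _).mul hwg).intervalIntegrable _ _),
      ← intervalIntegral.integral_add
        ((hwg2.sub ((LocBdd.const _).mul hwg)).intervalIntegrable _ _)
        (((LocBdd.const _).mul hw).intervalIntegrable _ _)]
    refine intervalIntegral.integral_congr fun p _ => ?_
    ring
  rw [h5, h1, h2, h3] at h4
  have h6 : 2 * (2 * κ / τ ^ 2) * κ - (2 * κ / τ ^ 2) ^ 2 * (τ ^ 2 / 2) = 2 / τ ^ 2 * κ ^ 2 := by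
    field_simp
    ring
  linarith

theorem integral_difference_error_le {y dy g : ℝ → ℝ} {τ T α : ℝ} (hτ : 0 < τ) (hT : τ ≤ T)
    (hα : 0 ≤ α) (hy : Continuous y) (hdy : Continuous dy) (hg : LocBdd g)
    (hd : ∀ t, 0 ≤ t → HasDerivWithinAt y (dy t) (Ici t) t)
    (hdd : ∀ t, 0 ≤ t → HasDerivWithinAt dy (g t) (Ici t) t) :
    4 / τ ^ 2 * Real.exp (-2 * α * τ) *
        ∫ t in τ..T, Real.exp (2 * α * t) * (y (t - τ) - y t + τ * dy t) ^ 2 ≤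
      τ ^ 2 * ∫ t in (0 : ℝ)..T, Real.exp (2 * α * t) * g t ^ 2 := by
  have hexp : LocBdd fun t => Real.exp (2 * α * t) := .of_continuous (by fun_prop)
  set G : ℝ → ℝ := fun t => Real.exp (2 * α * t) * g t ^ 2 with hGdef
  have hG : LocBdd G := hexp.mul hg.sq
  have hG0 : ∀ t, 0 ≤ G t := fun t => by positivity
  have hint : IntegrableOn (Function.uncurry fun t p : ℝ => (τ - p) * G (t - p))
      (uIoc τ T ×ˢ uIoc 0 τ) := by
    obtain ⟨C, hC⟩ := hG.bdd 0 T
    have hC0 : 0 ≤ C := (abs_nonneg _).trans (hC 0 ⟨le_rfl, hτ.le.trans hT⟩)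
    refine Measure.integrableOn_of_bounded (M := τ * C) ?_ ?_ ?_
    · rw [Measure.volume_eq_prod, Measure.prod_prod]
      exact ENNReal.mul_ne_top (by simp) (by simp)
    · refine Measurable.aestronglyMeasurable ?_
      exact (measurable_const.sub measurable_snd).mul
        (hG.measurable.comp (measurable_fst.sub measurable_snd))
    · refine (ae_restrict_iff' (measurableSet_uIoc.prod measurableSet_uIoc)).2
        (.of_forall fun x hx => ?_)
      rw [uIoc_of_le hT, uIoc_of_le hτ.le] at hx
      obtain ⟨⟨h1, h2⟩, h3, h4⟩ := hx
      simp only [Function.uncurry, Real.norm_eq_abs, abs_mul]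
      refine mul_le_mul ?_ (hC _ ⟨by linarith, by linarith⟩) (abs_nonneg _) hτ.le
      rw [abs_of_nonneg (by linarith)]
      linarith
  have hintL : IntervalIntegrable (fun t => ∫ p in (0 : ℝ)..τ, (τ - p) * G (t - p)) volume τ T := by
    rw [intervalIntegrable_iff]
    have h1 : Integrable (Function.uncurry fun t p : ℝ => (τ - p) * G (t - p))
        ((volume.restrict (uIoc τ T)).prod (volume.restrict (uIoc 0 τ))) := by
      rw [Measure.prod_restrict, ← Measure.volume_eq_prod]
      exact hint
    have h2 := h1.integral_prod_left
    refine h2.congr (.of_forall fun t => ?_)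
    simp only [Function.uncurry]
    rw [intervalIntegral.integral_of_le hτ.le, uIoc_of_le hτ.le]
  have hE : LocBdd fun t => Real.exp (2 * α * t) * (y (t - τ) - y t + τ * dy t) ^ 2 :=
    .of_continuous (by fun_prop)
  have step1 : ∫ t in τ..T, 2 / τ ^ 2 * Real.exp (-2 * α * τ) *
      (Real.exp (2 * α * t) * (y (t - τ) - y t + τ * dy t) ^ 2) ≤
      ∫ t in τ..T, ∫ p in (0 : ℝ)..τ, (τ - p) * G (t - p) := by
    refine intervalIntegral.integral_mono_on hT
      (((LocBdd.const _).mul hE).intervalIntegrable _ _) hintL fun t ht => ?_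
    have h1 := difference_error_sq_le hτ ht.1 hy hdy hg hd hdd
    have h2 : ∫ p in (0 : ℝ)..τ, Real.exp (-2 * α * τ) * Real.exp (2 * α * t) *
        ((τ - p) * g (t - p) ^ 2) ≤ ∫ p in (0 : ℝ)..τ, (τ - p) * G (t - p) := by
      have hr : LocBdd fun p => τ - p := .of_continuous (by fun_prop)
      have hrefl : ∀ F : ℝ → ℝ, LocBdd F → LocBdd fun p => F (t - p) := by
        intro F hF
        refine ⟨hF.measurable.comp (measurable_const.sub measurable_id), fun r s => ?_⟩
        obtain ⟨C, hC⟩ := hF.bdd (t - s) (t - r)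
        exact ⟨C, fun p hp => hC _ ⟨by linarith [hp.2], by linarith [hp.1]⟩⟩
      refine intervalIntegral.integral_mono_on hτ.le
        (((LocBdd.const _).mul (hr.mul (hrefl g hg).sq)).intervalIntegrable _ _)
        ((hr.mul (hrefl G hG)).intervalIntegrable _ _) fun p hp => ?_
      have e1 : Real.exp (-2 * α * τ) * Real.exp (2 * α * t) ≤ Real.exp (2 * α * (t - p)) := by
        rw [← Real.exp_add]
        exact Real.exp_le_exp.2 (by nlinarith [hp.2])
      have e2 : 0 ≤ (τ - p) * g (t - p) ^ 2 := mul_nonneg (by linarith [hp.2]) (sq_nonneg _)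
      calc _ ≤ Real.exp (2 * α * (t - p)) * ((τ - p) * g (t - p) ^ 2) :=
            mul_le_mul_of_nonneg_right e1 e2
        _ = _ := by simp only [hGdef]; ring
    rw [intervalIntegral.integral_const_mul] at h2
    have e3 : 0 ≤ Real.exp (-2 * α * τ) * Real.exp (2 * α * t) := by positivity
    calc _ = Real.exp (-2 * α * τ) * Real.exp (2 * α * t) *
          (2 / τ ^ 2 * (y (t - τ) - y t + τ * dy t) ^ 2) := by ring
      _ ≤ _ := (mul_le_mul_of_nonneg_left h1 e3).trans h2
  rw [intervalIntegral_intervalIntegral_swap hint,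
    intervalIntegral.integral_const_mul] at step1
  have step2 : ∫ p in (0 : ℝ)..τ, ∫ t in τ..T, (τ - p) * G (t - p) ≤
      ∫ p in (0 : ℝ)..τ, (τ - p) * ∫ t in (0 : ℝ)..T, G t := by
    have hint' : IntervalIntegrable (fun p => ∫ t in τ..T, (τ - p) * G (t - p)) volume 0 τ := by
      rw [intervalIntegrable_iff]
      have h1 : Integrable (Function.uncurry fun t p : ℝ => (τ - p) * G (t - p))
          ((volume.restrict (uIoc τ T)).prod (volume.restrict (uIoc 0 τ))) := by
        rw [Measure.prod_restrict, ← Measure.volume_eq_prod]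
        exact hint
      have h2 := h1.integral_prod_right
      refine h2.congr (.of_forall fun t => ?_)
      simp only [Function.uncurry]
      rw [intervalIntegral.integral_of_le hT, uIoc_of_le hT]
    have hr : Continuous fun p => (τ - p) * ∫ t in (0 : ℝ)..T, G t := by fun_prop
    refine intervalIntegral.integral_mono_on hτ.le hint' (hr.intervalIntegrable _ _) fun p hp => ?_
    rw [intervalIntegral.integral_const_mul, intervalIntegral.integral_comp_sub_right]
    refine mul_le_mul_of_nonneg_left ?_ (by linarith [hp.2])
    refine intervalIntegral.integral_mono_interval (by linarith [hp.2]) (by linarith)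
      (by linarith [hp.1]) (.of_forall hG0) (hG.intervalIntegrable _ _)
  rw [intervalIntegral.integral_mul_const, integral_ramp] at step2
  have := step1.trans step2
  calc _ = 2 * (2 / τ ^ 2 * Real.exp (-2 * α * τ) *
        ∫ t in τ..T, Real.exp (2 * α * t) * (y (t - τ) - y t + τ * dy t) ^ 2) := by ring
    _ ≤ 2 * (τ ^ 2 / 2 * ∫ t in (0 : ℝ)..T, G t) := by linarith
    _ = _ := by ring

end Inequalities

section QuadraticForm

/-! ### The quadratic form of the linear matrix inequality -/

theorem sumElim_dotProduct_fromBlocks_mulVec {m n : Type*} [Fintype m] [Fintype n]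
    (A : Matrix m m ℝ) (B : Matrix m n ℝ) (D : Matrix n n ℝ) (x : m → ℝ) (y : n → ℝ) :
    Sum.elim x y ⬝ᵥ (Matrix.fromBlocks A B Bᵀ D *ᵥ Sum.elim x y) =
      x ⬝ᵥ (A *ᵥ x) + 2 * (x ⬝ᵥ (B *ᵥ y)) + y ⬝ᵥ (D *ᵥ y) := by
  have h : y ⬝ᵥ (Bᵀ *ᵥ x) = x ⬝ᵥ (B *ᵥ y) := by
    rw [Matrix.mulVec_transpose, dotProduct_comm, Matrix.dotProduct_mulVec]
  rw [Matrix.fromBlocks_mulVec, sumElim_dotProduct_sumElim]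
  simp only [Sum.elim_comp_inl, Sum.elim_comp_inr, dotProduct_add, h]
  ring

theorem dotProduct_fromCols_mulVec {m n k : Type*} [Fintype m] [Fintype n] [Fintype k]
    (B : Matrix m n ℝ) (C : Matrix m k ℝ) (x : m → ℝ) (y : n → ℝ) (z : k → ℝ) :
    x ⬝ᵥ (Matrix.fromCols B C *ᵥ Sum.elim y z) = x ⬝ᵥ (B *ᵥ y) + x ⬝ᵥ (C *ᵥ z) := by
  rw [Matrix.fromCols_mulVec_sumElim, dotProduct_add]

theorem dotProduct_transpose_mulVec_eq {m n : Type*} [Fintype m] [Fintype n]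
    (M : Matrix m n ℝ) (x : n → ℝ) (y : m → ℝ) : x ⬝ᵥ (Mᵀ *ᵥ y) = (M *ᵥ x) ⬝ᵥ y := by
  rw [Matrix.mulVec_transpose, dotProduct_comm, ← Matrix.dotProduct_mulVec, dotProduct_comm]

theorem quadratic_form_le {a₁ a₂ b h kp ki kd σ α W R ω : ℝ} {q : ℕ}
    {P S : Matrix (Fin 3) (Fin 3) ℝ} (hP : P.IsHermitian)
    (hΨ : (-(matΨ a₁ a₂ b h q kp ki kd σ α P S W R ω)).PosSemidef)
    (x v w : Fin 3 → ℝ) (δ κ e u : ℝ)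
    (hw : w = matA a₁ a₂ b h q kp ki kd *ᵥ x + √h • (matAv b kp ki *ᵥ v)
      + matB b *ᵥ (fun _ => δ + κ + e))
    (hu : u = (kp + kd) * x 0 - q * h * kd * x 1 + ki * x 2 + √h * (kp * v 0 + ki * v 2)
      + δ + κ) :
    2 * (x ⬝ᵥ (P *ᵥ w)) + 2 * α * (x ⬝ᵥ (P *ᵥ x))
      + W * kd ^ 2 * h ^ 2 * Real.exp (2 * α * h) * x 1 ^ 2
      + h ^ 2 * Real.exp (2 * α * h) * (w ⬝ᵥ (S *ᵥ w)) + R * kd ^ 2 * (q * h) ^ 2 * w 1 ^ 2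
      - Real.pi ^ 2 / 4 * h * (v ⬝ᵥ (S *ᵥ v))
      - W * (Real.pi ^ 2 / 4) * Real.exp (-2 * α * q * h) * δ ^ 2
      - R * (4 / (q * h) ^ 2) * Real.exp (-2 * α * q * h) * κ ^ 2
      + ω * σ * u ^ 2 - ω * e ^ 2 ≤ 0 := by
  have key := hΨ.dotProduct_mulVec_nonneg (Sum.elim x (Sum.elim v (Sum.elim (fun _ => δ)
    (Sum.elim (fun _ => κ) (Sum.elim (fun _ => e) (Sum.elim (fun _ => u) w))))))
  rw [Matrix.neg_mulVec, dotProduct_neg, star_trivial] at key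
  unfold matΨ at key
  simp only [sumElim_dotProduct_fromBlocks_mulVec, dotProduct_fromCols_mulVec, Matrix.add_mulVec,
    Matrix.smul_mulVec, ← Matrix.mulVec_mulVec, dotProduct_add, dotProduct_smul, smul_eq_mul,
    Matrix.zero_mulVec, dotProduct_zero, Matrix.neg_mulVec, dotProduct_neg] at key
  simp only [dotProduct_transpose_mulVec_eq] at key
  have hB : matB b *ᵥ (fun _ => δ + κ + e) = matB b *ᵥ (fun _ => δ) + matB b *ᵥ (fun _ => κ)
      + matB b *ᵥ (fun _ => e) := by
    rw [← Matrix.mulVec_add, ← Matrix.mulVec_add]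
    rfl
  rw [hB] at hw
  have hPw : x ⬝ᵥ (P *ᵥ w) = x ⬝ᵥ (P *ᵥ matA a₁ a₂ b h q kp ki kd *ᵥ x)
      + √h * (x ⬝ᵥ (P *ᵥ matAv b kp ki *ᵥ v)) + (x ⬝ᵥ (P *ᵥ matB b *ᵥ fun _ => δ)
      + x ⬝ᵥ (P *ᵥ matB b *ᵥ fun _ => κ) + x ⬝ᵥ (P *ᵥ matB b *ᵥ fun _ => e)) := by
    rw [hw]
    simp only [Matrix.mulVec_add, Matrix.mulVec_smul, dotProduct_add, dotProduct_smul, smul_eq_mul]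
  have hAP : (matA a₁ a₂ b h q kp ki kd *ᵥ x) ⬝ᵥ (P *ᵥ x)
      = x ⬝ᵥ (P *ᵥ matA a₁ a₂ b h q kp ki kd *ᵥ x) := by
    have hPt : Pᵀ = P := hP
    have h := dotProduct_transpose_mulVec_eq P x (matA a₁ a₂ b h q kp ki kd *ᵥ x)
    rw [hPt] at h
    rw [h, dotProduct_comm]
  have hE : ∀ x : Fin 3 → ℝ, x ⬝ᵥ (matE *ᵥ x) = x 1 ^ 2 := by
    intro x
    simp [matE, dotProduct, Matrix.mulVec, Fin.sum_univ_three]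
    ring
  have hG : w ⬝ᵥ (matG h q kd α S R *ᵥ w) = h ^ 2 * Real.exp (2 * α * h) * (w ⬝ᵥ (S *ᵥ w))
      + R * kd ^ 2 * (q * h) ^ 2 * w 1 ^ 2 := by
    simp only [matG, Matrix.add_mulVec, Matrix.smul_mulVec, dotProduct_add, dotProduct_smul,
      smul_eq_mul, hE]
  have hGw : ∀ g : Fin 3 → ℝ, w ⬝ᵥ g = (matA a₁ a₂ b h q kp ki kd *ᵥ x) ⬝ᵥ g
      + √h * ((matAv b kp ki *ᵥ v) ⬝ᵥ g) + ((matB b *ᵥ fun _ => δ) ⬝ᵥ g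
      + (matB b *ᵥ fun _ => κ) ⬝ᵥ g + (matB b *ᵥ fun _ => e) ⬝ᵥ g) := by
    intro g
    nth_rw 1 [hw]
    simp only [add_dotProduct, smul_dotProduct, smul_eq_mul]
  have hGw' := hGw (matG h q kd α S R *ᵥ w)
  have hK1 : x ⬝ᵥ (!![kp + kd; -(q * h * kd); ki] *ᵥ fun _ : Fin 1 => u)
      = ((kp + kd) * x 0 - q * h * kd * x 1 + ki * x 2) * u := by
    simp [dotProduct, Matrix.mulVec, Fin.sum_univ_three]
    ring
  have hK2 : v ⬝ᵥ (!![kp; 0; ki] *ᵥ fun _ : Fin 1 => u) = (kp * v 0 + ki * v 2) * u := by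
    simp [dotProduct, Matrix.mulVec, Fin.sum_univ_three]
    ring
  have h11 : ∀ c r s : ℝ, (fun _ : Fin 1 => r) ⬝ᵥ (!![c] *ᵥ fun _ : Fin 1 => s) = c * r * s := by
    intro c r s
    simp [dotProduct, Matrix.mulVec]
    ring
  rw [hE, hK1, hK2, hAP] at key
  simp only [h11] at key
  rw [hPw]
  have huu : ω * σ * u * u = ω * σ * u * ((kp + kd) * x 0 - q * h * kd * x 1 + ki * x 2
      + √h * (kp * v 0 + ki * v 2) + δ + κ) := by rw [← hu]
  linarith

end QuadraticForm

section Lyapunov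

/-! ### Quadratic forms -/

theorem dotProduct_mulVec_comm_of_isHermitian {n : Type*} [Fintype n] {P : Matrix n n ℝ}
    (hP : P.IsHermitian) (x w : n → ℝ) : w ⬝ᵥ (P *ᵥ x) = x ⬝ᵥ (P *ᵥ w) := by
  have hPt : Pᵀ = P := hP
  have h := dotProduct_transpose_mulVec_eq P w x
  rw [hPt] at h
  rw [h, dotProduct_comm]

theorem hasDerivWithinAt_quadratic {n : Type*} [Fintype n] {P : Matrix n n ℝ}
    (hP : P.IsHermitian) {x : ℝ → n → ℝ} {w : n → ℝ} {s : Set ℝ} {t : ℝ}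
    (hx : ∀ i, HasDerivWithinAt (fun t => x t i) (w i) s t) :
    HasDerivWithinAt (fun t => x t ⬝ᵥ (P *ᵥ x t)) (2 * (x t ⬝ᵥ (P *ᵥ w))) s t := by
  have h1 : HasDerivWithinAt (fun t => ∑ i, x t i * ∑ j, P i j * x t j)
      (∑ i, (w i * ∑ j, P i j * x t j + x t i * ∑ j, P i j * w j)) s t :=
    HasDerivWithinAt.fun_sum fun i _ => (hx i).mul
      (HasDerivWithinAt.fun_sum fun j _ => (hx j).const_mul (P i j))
  refine h1.congr_deriv ?_
  have h2 := dotProduct_mulVec_comm_of_isHermitian hP (x t) w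
  rw [Finset.sum_add_distrib]
  change w ⬝ᵥ (P *ᵥ x t) + x t ⬝ᵥ (P *ᵥ w) = _
  rw [h2]; ring

theorem exists_coercive {n : Type*} [Fintype n] {P : Matrix n n ℝ} (hP : P.PosDef) :
    ∃ c : ℝ, 0 < c ∧ ∀ (x : n → ℝ) (i : n), c * x i ^ 2 ≤ x ⬝ᵥ (P *ᵥ x) := by
  classical
  rcases isEmpty_or_nonempty n with hn | hn
  · exact ⟨1, one_pos, fun _ i => (hn.false i).elim⟩
  have hcont : Continuous fun x : n → ℝ => x ⬝ᵥ (P *ᵥ x) := by fun_prop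
  have hne : (Metric.sphere (0 : n → ℝ) 1).Nonempty := NormedSpace.sphere_nonempty.2 zero_le_one
  obtain ⟨z, hz, hmin⟩ := (isCompact_sphere (0 : n → ℝ) 1).exists_isMinOn hne hcont.continuousOn
  have hz0 : z ≠ 0 := by
    rintro rfl
    simp at hz
  refine ⟨z ⬝ᵥ (P *ᵥ z), by simpa using hP.dotProduct_mulVec_pos hz0, fun x i => ?_⟩
  have hzpos : 0 < z ⬝ᵥ (P *ᵥ z) := by simpa using hP.dotProduct_mulVec_pos hz0
  rcases eq_or_ne x 0 with rfl | hx
  · simp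
  have hxn : 0 < ‖x‖ := norm_pos_iff.2 hx
  have hmem : ‖x‖⁻¹ • x ∈ Metric.sphere (0 : n → ℝ) 1 := by
    simp [norm_smul, hxn.ne']
  have h1 : z ⬝ᵥ (P *ᵥ z) ≤ ‖x‖⁻¹ * (‖x‖⁻¹ * (x ⬝ᵥ (P *ᵥ x))) := by
    have := hmin hmem
    simpa [Matrix.mulVec_smul] using this
  have h2 : x i ^ 2 ≤ ‖x‖ ^ 2 := by
    rw [← sq_abs]
    exact pow_le_pow_left₀ (abs_nonneg _) (norm_le_pi_norm x i) 2
  calc _ ≤ z ⬝ᵥ (P *ᵥ z) * ‖x‖ ^ 2 := mul_le_mul_of_nonneg_left h2 hzpos.le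
    _ ≤ ‖x‖⁻¹ * (‖x‖⁻¹ * (x ⬝ᵥ (P *ᵥ x))) * ‖x‖ ^ 2 :=
      mul_le_mul_of_nonneg_right h1 (sq_nonneg _)
    _ = _ := by field_simp

theorem quadratic_le {n : Type*} [Fintype n] (P : Matrix n n ℝ) {x : n → ℝ} {D : ℝ}
    (hx : ∀ i, |x i| ≤ D) : x ⬝ᵥ (P *ᵥ x) ≤ (∑ i, ∑ j, |P i j|) * D ^ 2 := by
  simp only [dotProduct, Matrix.mulVec, Finset.mul_sum, Finset.sum_mul]
  refine Finset.sum_le_sum fun i _ => Finset.sum_le_sum fun j _ => ?_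
  have hD : 0 ≤ D := (abs_nonneg _).trans (hx i)
  calc _ ≤ |x i * (P i j * x j)| := le_abs_self _
    _ = |P i j| * (|x i| * |x j|) := by rw [abs_mul, abs_mul]; ring
    _ ≤ |P i j| * (D * D) := mul_le_mul_of_nonneg_left
        (mul_le_mul (hx i) (hx j) (abs_nonneg _) hD) (abs_nonneg _)
    _ = _ := by ring

theorem exists_quadratic_eq_sum_sq {n : Type*} [Fintype n] [DecidableEq n] {S : Matrix n n ℝ}
    (hS : S.PosSemidef) :
    ∃ C : Matrix n n ℝ, ∀ x : n → ℝ, x ⬝ᵥ (S *ᵥ x) = ∑ i, (C *ᵥ x) i ^ 2 := by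
  open scoped MatrixOrder in
  obtain ⟨C, rfl⟩ := CStarAlgebra.nonneg_iff_eq_star_mul_self.mp hS.nonneg
  refine ⟨C, fun x => ?_⟩
  have h1 : star C = Cᵀ := rfl
  rw [h1, ← Matrix.mulVec_mulVec, dotProduct_transpose_mulVec_eq]
  simp only [dotProduct, sq]

/-! ### The state of the event-triggered closed loop -/

variable {a₁ a₂ b h kp ki kd σ : ℝ} {q : ℕ} {y dy : ℝ → ℝ}

/-- The integral state, extended continuously to negative times. -/
noncomputable def integralState (h : ℝ) (y : ℝ → ℝ) (t : ℝ) : ℝ :=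
  ∫ s in (0 : ℝ)..t, y ((⌊s / h⌋₊ : ℝ) * h)

theorem continuous_integralState (hh : 0 < h) (y : ℝ → ℝ) : Continuous (integralState h y) :=
  intervalIntegral.continuous_primitive
    (LocBdd.step hh (fun k => y ((k : ℝ) * h))).intervalIntegrable 0

theorem hasDerivWithinAt_integralState (hh : 0 < h) (y : ℝ → ℝ) {t : ℝ} (ht : 0 ≤ t) :
    HasDerivWithinAt (integralState h y) (y ((⌊t / h⌋₊ : ℝ) * h)) (Ici t) t :=
  (hasDerivWithinAt_sampledIntegral hh y ht).congr
    (fun _ hs => (sampledIntegral_eq_integral hh y (ht.trans hs)).symm)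
    (sampledIntegral_eq_integral hh y ht).symm

/-- The state `(y, y', x₃)`. -/
noncomputable def stateVec (h : ℝ) (y dy : ℝ → ℝ) (t : ℝ) : Fin 3 → ℝ :=
  ![y t, dy t, integralState h y t]

/-- The right derivative of the state. -/
noncomputable def stateDeriv (a₁ a₂ b h : ℝ) (q : ℕ) (kp ki kd σ : ℝ) (y dy : ℝ → ℝ) (t : ℝ) :
    Fin 3 → ℝ :=
  ![dy t, eventAccel a₁ a₂ b h q kp ki kd σ y dy t, y ((⌊t / h⌋₊ : ℝ) * h)]

theorem continuous_stateVec (hh : 0 < h) (hy : Continuous y) (hdy : Continuous dy) (i : Fin 3) :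
    Continuous fun t => stateVec h y dy t i := by
  fin_cases i
  · exact hy
  · exact hdy
  · exact continuous_integralState hh y

theorem locBdd_stateDeriv (hh : 0 < h) (hy : Continuous y) (hdy : Continuous dy) (i : Fin 3) :
    LocBdd fun t => stateDeriv a₁ a₂ b h q kp ki kd σ y dy t i := by
  fin_cases i
  · exact .of_continuous hdy
  · exact locBdd_eventAccel hh hy hdy
  · exact LocBdd.step hh fun k => y ((k : ℝ) * h)

theorem IsEventSolution.hasDeriv_stateVec (hh : 0 < h)
    (hs : IsEventSolution a₁ a₂ b h q kp ki kd σ y dy) {t : ℝ} (ht : 0 ≤ t) (i : Fin 3) :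
    HasDerivWithinAt (fun t => stateVec h y dy t i)
      (stateDeriv a₁ a₂ b h q kp ki kd σ y dy t i) (Ici t) t := by
  fin_cases i
  · exact hs.hasDeriv_y_right ht
  · exact hs.hasDeriv_dy_right hh ht
  · exact hasDerivWithinAt_integralState hh y ht

theorem sampledControl_eq (hh : 0 < h) {k : ℕ} (hk : q ≤ k) :
    sampledControl h q kp ki kd y k = kp * y (k * h) + ki * integralState h y (k * h)
      + kd * y (k * h - q * h) := by
  have h1 : integralState h y (k * h) = h * ∑ j ∈ Finset.range k, y ((j : ℝ) * h) := by
    rw [← sampledIntegral_grid hh]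
    exact (sampledIntegral_eq_integral hh y (by positivity)).symm
  unfold sampledControl delayedSample
  rw [if_neg hk.not_gt, h1, Nat.cast_sub hk]
  ring_nf

/-- The dissipation inequality along solutions. -/
theorem dissipation_le {α W R ω : ℝ} {P S : Matrix (Fin 3) (Fin 3) ℝ} (hh : 0 < h)
    (hσ : 0 ≤ σ) (hω : 0 ≤ ω) (hP : P.IsHermitian)
    (hΨ : (-(matΨ a₁ a₂ b h q kp ki kd σ α P S W R ω)).PosSemidef) {t : ℝ}
    (ht : q * h ≤ t) :
    2 * (stateVec h y dy t ⬝ᵥ (P *ᵥ stateDeriv a₁ a₂ b h q kp ki kd σ y dy t))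
        + 2 * α * (stateVec h y dy t ⬝ᵥ (P *ᵥ stateVec h y dy t)) ≤
      -(W * kd ^ 2 * (h ^ 2 * Real.exp (2 * α * h)) * dy t ^ 2)
      - h ^ 2 * Real.exp (2 * α * h) * (stateDeriv a₁ a₂ b h q kp ki kd σ y dy t ⬝ᵥ
          (S *ᵥ stateDeriv a₁ a₂ b h q kp ki kd σ y dy t))
      - R * kd ^ 2 * (q * h) ^ 2 * eventAccel a₁ a₂ b h q kp ki kd σ y dy t ^ 2
      + Real.pi ^ 2 / 4 * ((stateVec h y dy t - stateVec h y dy ((⌊t / h⌋₊ : ℝ) * h)) ⬝ᵥ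
          (S *ᵥ (stateVec h y dy t - stateVec h y dy ((⌊t / h⌋₊ : ℝ) * h))))
      + W * kd ^ 2 * Real.exp (-2 * α * (q * h)) * (Real.pi ^ 2 / 4) *
          (y (t - q * h) - y ((⌊t / h⌋₊ : ℝ) * h - q * h)) ^ 2
      + R * kd ^ 2 * (4 / (q * h) ^ 2 * Real.exp (-2 * α * (q * h))) *
          (y (t - q * h) - y t + q * h * dy t) ^ 2 := by
  have hk : q ≤ ⌊t / h⌋₊ := Nat.le_floor ((le_div_iff₀ hh).2 ht)
  set k := ⌊t / h⌋₊ with hkdef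
  set x := stateVec h y dy t with hx
  set w := stateDeriv a₁ a₂ b h q kp ki kd σ y dy t with hw
  set d := stateVec h y dy t - stateVec h y dy ((k : ℝ) * h) with hd
  set U := sampledControl h q kp ki kd y k with hU
  set e := eventControl σ (sampledControl h q kp ki kd y) k - U with he
  set δ := kd * (y (k * h - q * h) - y (t - q * h)) with hδ
  set κ := kd * (y (t - q * h) - y t + q * h * dy t) with hκ
  have hsq : √h * (√h)⁻¹ = 1 := mul_inv_cancel₀ (Real.sqrt_ne_zero'.2 hh)
  have hUeq : U = kp * y (k * h) + ki * integralState h y (k * h) + kd * y (k * h - q * h) :=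
    sampledControl_eq hh hk
  have hv : ∀ i, √h * (-(√h)⁻¹ * d i) = -d i := by
    intro i
    linear_combination -d i * hsq
  have key := quadratic_form_le hP hΨ x (-(√h)⁻¹ • d) w δ κ e U ?_ ?_
  · have hdS : h * ((-(√h)⁻¹ • d) ⬝ᵥ (S *ᵥ (-(√h)⁻¹ • d))) = d ⬝ᵥ (S *ᵥ d) := by
      rw [Matrix.mulVec_smul, dotProduct_smul, smul_dotProduct, smul_eq_mul, smul_eq_mul]
      have : h = √h * √h := (Real.mul_self_sqrt hh.le).symm
      have h2 : h * (√h)⁻¹ * (√h)⁻¹ = 1 := by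
        nth_rw 1 [this]
        linear_combination (√h * (√h)⁻¹ + 1) * hsq
      linear_combination (d ⬝ᵥ (S *ᵥ d)) * h2
    have hev := mul_le_mul_of_nonneg_left
      (eventControl_sub_sq_le hσ (sampledControl h q kp ki kd y) k) hω
    have e1 : x 1 = dy t := rfl
    have e2 : w 1 = eventAccel a₁ a₂ b h q kp ki kd σ y dy t := rfl
    rw [e1, e2, mul_assoc (Real.pi ^ 2 / 4) h, hdS] at key
    have hexp : -2 * α * q * h = -2 * α * (q * h) := by ring
    rw [hexp] at key
    have e3 : δ ^ 2 = kd ^ 2 * (y (t - q * h) - y (k * h - q * h)) ^ 2 := by rw [hδ]; ring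
    have e4 : κ ^ 2 = kd ^ 2 * (y (t - q * h) - y t + q * h * dy t) ^ 2 := by rw [hκ]; ring
    rw [e3, e4] at key
    change ω * e ^ 2 ≤ ω * (σ * U ^ 2) at hev
    linarith
  · have d0 : d 0 = y t - y (k * h) := rfl
    have d2 : d 2 = integralState h y t - integralState h y (k * h) := rfl
    have x0 : x 0 = y t := rfl
    have x1 : x 1 = dy t := rfl
    have x2 : x 2 = integralState h y t := rfl
    have w1 : w 1 = b * (U + e) - a₁ * dy t - a₂ * y t := by
      rw [he, add_sub_cancel]; rfl
    have hv0 := hv 0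
    have hv2 := hv 2
    funext i
    fin_cases i
    · have : w 0 = dy t := rfl
      simp [matA, matAv, matB, dotProduct, Fin.sum_univ_three, this, x1]
    · simp [matA, matAv, matB, dotProduct, Fin.sum_univ_three, w1, x0, x1, x2]
      rw [hUeq, hδ, hκ]
      linear_combination -b * kp * hv0 - b * ki * hv2 + b * kp * d0 + b * ki * d2
    · have : w 2 = y (k * h) := rfl
      simp [matA, matAv, matB, dotProduct, Fin.sum_univ_three, this, x0]
      linear_combination -hv0 + d0
  · have d0 : d 0 = y t - y (k * h) := rfl
    have d2 : d 2 = integralState h y t - integralState h y (k * h) := rfl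
    have x0 : x 0 = y t := rfl
    have x1 : x 1 = dy t := rfl
    have x2 : x 2 = integralState h y t := rfl
    have hv0 := hv 0
    have hv2 := hv 2
    simp only [Pi.smul_apply, smul_eq_mul]
    rw [hUeq, hδ, hκ, x0, x1, x2]
    linear_combination -kp * hv0 - ki * hv2 + kp * d0 + ki * d2

end Lyapunov

section LMI

/-! ### Exponential stability from the linear matrix inequality -/

variable {a₁ a₂ b h kp ki kd σ : ℝ} {q : ℕ} {y dy : ℝ → ℝ}

theorem LocBdd.mulVec {m n : Type*} [Fintype n] (Q : Matrix m n ℝ) {f : ℝ → n → ℝ}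
    (hf : ∀ j, LocBdd fun t => f t j) (i : m) : LocBdd fun t => (Q *ᵥ f t) i :=
  LocBdd.sum Finset.univ fun j => (LocBdd.const (Q i j)).mul (hf j)

theorem continuous_mulVec_apply {m n : Type*} [Fintype n] (Q : Matrix m n ℝ) {f : ℝ → n → ℝ}
    (hf : ∀ j, Continuous fun t => f t j) (i : m) : Continuous fun t => (Q *ᵥ f t) i :=
  continuous_finsetSum Finset.univ fun j _ => (hf j).const_mul (Q i j)

theorem integral_quadratic_sampling_error_le {n : Type*} [Fintype n] [DecidableEq n]
    {S : Matrix n n ℝ} (hS : S.PosSemidef) {α T : ℝ} (hh : 0 < h) (hα : 0 ≤ α)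
    {x w : ℝ → n → ℝ} (hx : ∀ i, Continuous fun t => x t i) (hw : ∀ i, LocBdd fun t => w t i)
    (hd : ∀ t, 0 ≤ t → ∀ i, HasDerivWithinAt (fun t => x t i) (w t i) (Ici t) t) (m : ℕ)
    (hT : m * h ≤ T) :
    Real.pi ^ 2 / 4 * ∫ t in (m * h)..T, Real.exp (2 * α * t) *
        ((x t - x ((⌊t / h⌋₊ : ℝ) * h)) ⬝ᵥ (S *ᵥ (x t - x ((⌊t / h⌋₊ : ℝ) * h)))) ≤
      h ^ 2 * Real.exp (2 * α * h) *
        ∫ t in (m * h)..T, Real.exp (2 * α * t) * (w t ⬝ᵥ (S *ᵥ w t)) := by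
  obtain ⟨C, hC⟩ := exists_quadratic_eq_sum_sq hS
  have hexp : LocBdd fun t => Real.exp (2 * α * t) := .of_continuous (by fun_prop)
  have hCx : ∀ i, Continuous fun t => (C *ᵥ x t) i := 
    continuous_mulVec_apply C hx
  have hCw : ∀ i, LocBdd fun t => (C *ᵥ w t) i := 
    LocBdd.mulVec C hw
  have hCd : ∀ i t, 0 ≤ t → HasDerivWithinAt (fun t => (C *ᵥ x t) i) ((C *ᵥ w t) i) (Ici t) t :=
    fun i t ht => HasDerivWithinAt.fun_sum fun j _ => (hd t ht j).const_mul _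
  have hsub : ∀ i, LocBdd fun t => Real.exp (2 * α * t) *
      ((C *ᵥ x t) i - (C *ᵥ x ((⌊t / h⌋₊ : ℝ) * h)) i) ^ 2 := fun i =>
    hexp.mul ((LocBdd.of_continuous (hCx i)).sub
      (LocBdd.step hh fun k => (C *ᵥ x ((k : ℝ) * h)) i)).sq
  simp only [hC]
  simp only [Matrix.mulVec_sub, Pi.sub_apply, Finset.mul_sum]
  rw [intervalIntegral.integral_finsetSum fun i _ => (hsub i).intervalIntegrable _ _,
    intervalIntegral.integral_finsetSum
      fun i _ => (hexp.mul (hCw i).sq).intervalIntegrable _ _, Finset.mul_sum, Finset.mul_sum]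
  exact Finset.sum_le_sum fun i _ =>
    integral_sampling_error_le hh hα (hCx i) (hCw i) (hCd i) m hT

theorem lyapunov_le {α W R ω : ℝ} {P S : Matrix (Fin 3) (Fin 3) ℝ} (hh : 0 < h) (hq : 0 < q)
    (hα : 0 ≤ α) (hσ : 0 ≤ σ) (hW : 0 ≤ W) (hR : 0 ≤ R) (hω : 0 ≤ ω) (hP : P.IsHermitian)
    (hS : S.PosSemidef)
    (hΨ : (-(matΨ a₁ a₂ b h q kp ki kd σ α P S W R ω)).PosSemidef)
    (hy : Continuous y) (hdy : Continuous dy)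
    (hs : IsEventSolution a₁ a₂ b h q kp ki kd σ y dy) {T : ℝ} (hT : q * h ≤ T) :
    Real.exp (2 * α * T) * (stateVec h y dy T ⬝ᵥ (P *ᵥ stateVec h y dy T)) ≤
      Real.exp (2 * α * (q * h)) * (stateVec h y dy (q * h) ⬝ᵥ (P *ᵥ stateVec h y dy (q * h)))
      + W * kd ^ 2 * (h ^ 2 * Real.exp (2 * α * h)) *
          (∫ t in (0 : ℝ)..(q * h), Real.exp (2 * α * t) * dy t ^ 2)
      + R * kd ^ 2 * (q * h) ^ 2 * (∫ t in (0 : ℝ)..(q * h), Real.exp (2 * α * t) *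
          eventAccel a₁ a₂ b h q kp ki kd σ y dy t ^ 2) := by
  set acc := eventAccel a₁ a₂ b h q kp ki kd σ y dy with hacc
  set x := stateVec h y dy with hx
  set w := stateDeriv a₁ a₂ b h q kp ki kd σ y dy with hw
  set τ : ℝ := q * h with hτ
  have hτ0 : 0 < τ := by positivity
  have hexp : LocBdd fun t => Real.exp (2 * α * t) := .of_continuous (by fun_prop)
  have hxc : ∀ i, Continuous fun t => x t i := continuous_stateVec hh hy hdy
  have hwb : ∀ i, LocBdd fun t => w t i := locBdd_stateDeriv hh hy hdy
  have hxd : ∀ t, 0 ≤ t → ∀ i, HasDerivWithinAt (fun t => x t i) (w t i) (Ici t) t :=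
    fun t ht i => hs.hasDeriv_stateVec hh ht i
  have hxb : ∀ i, LocBdd fun t => x t i := fun i => .of_continuous (hxc i)
  have hquad : ∀ (Q : Matrix (Fin 3) (Fin 3) ℝ) (f g : ℝ → Fin 3 → ℝ),
      (∀ i, LocBdd fun t => f t i) → (∀ i, LocBdd fun t => g t i) →
      LocBdd fun t => f t ⬝ᵥ (Q *ᵥ g t) := fun Q f g hf hg =>
    LocBdd.sum _ fun i => (hf i).mul (LocBdd.mulVec Q hg i)
  have hdb : ∀ i, LocBdd fun t => (x t - x ((⌊t / h⌋₊ : ℝ) * h)) i := fun i =>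
    (hxb i).sub (LocBdd.step hh fun k => x ((k : ℝ) * h) i)
  have haccb : LocBdd acc := locBdd_eventAccel hh hy hdy
  -- the six integrands
  set I₀ : ℝ → ℝ := fun t => Real.exp (2 * α * t) * dy t ^ 2 with hI₀
  set I₁ : ℝ → ℝ := fun t => Real.exp (2 * α * t) * (w t ⬝ᵥ (S *ᵥ w t)) with hI₁
  set I₂ : ℝ → ℝ := fun t => Real.exp (2 * α * t) * acc t ^ 2 with hI₂
  set J₁ : ℝ → ℝ := fun t => Real.exp (2 * α * t) *
    ((x t - x ((⌊t / h⌋₊ : ℝ) * h)) ⬝ᵥ (S *ᵥ (x t - x ((⌊t / h⌋₊ : ℝ) * h)))) with hJ₁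
  set J₂ : ℝ → ℝ := fun t => Real.exp (2 * α * t) *
    (y (t - τ) - y ((⌊t / h⌋₊ : ℝ) * h - τ)) ^ 2 with hJ₂
  set J₃ : ℝ → ℝ := fun t => Real.exp (2 * α * t) * (y (t - τ) - y t + τ * dy t) ^ 2 with hJ₃
  have bI₀ : LocBdd I₀ := hexp.mul (LocBdd.of_continuous hdy).sq
  have bI₁ : LocBdd I₁ := hexp.mul (hquad S w w hwb hwb)
  have bI₂ : LocBdd I₂ := hexp.mul haccb.sq
  have bJ₁ : LocBdd J₁ := hexp.mul (hquad S _ _ hdb hdb)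
  have bJ₂ : LocBdd J₂ := hexp.mul (((LocBdd.of_continuous hy).comp_sub_const τ).sub
    (LocBdd.step hh fun k => y ((k : ℝ) * h - τ))).sq
  have bJ₃ : LocBdd J₃ := .of_continuous (by fun_prop)
  have nI₀ : ∀ t, 0 ≤ I₀ t := fun t => by positivity
  set c₀ := W * kd ^ 2 * (h ^ 2 * Real.exp (2 * α * h)) with hc₀
  set c₁ := h ^ 2 * Real.exp (2 * α * h) with hc₁
  set c₂ := R * kd ^ 2 * τ ^ 2 with hc₂
  set d₂ := W * kd ^ 2 * Real.exp (-2 * α * τ) * (Real.pi ^ 2 / 4) with hd₂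
  set d₃ := R * kd ^ 2 * (4 / τ ^ 2 * Real.exp (-2 * α * τ)) with hd₃
  have hWk : 0 ≤ W * kd ^ 2 := by positivity
  have hRk : 0 ≤ R * kd ^ 2 := by positivity
  -- the derivative of the Lyapunov function
  have step1 : Real.exp (2 * α * T) * (x T ⬝ᵥ (P *ᵥ x T)) -
      Real.exp (2 * α * τ) * (x τ ⬝ᵥ (P *ᵥ x τ)) ≤
      ∫ t in τ..T, (-c₀) * I₀ t + (-c₁) * I₁ t + (-c₂) * I₂ t + Real.pi ^ 2 / 4 * J₁ t
        + d₂ * J₂ t + d₃ * J₃ t := by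
    refine intervalIntegral.sub_le_integral_of_hasDeriv_right_of_le
      (g := fun t => Real.exp (2 * α * t) * (x t ⬝ᵥ (P *ᵥ x t)))
      (g' := fun t => Real.exp (2 * α * t) * (2 * α) * (x t ⬝ᵥ (P *ᵥ x t)) +
        Real.exp (2 * α * t) * (2 * (x t ⬝ᵥ (P *ᵥ w t)))) hT ?_ ?_ ?_ ?_
    · refine Continuous.continuousOn (Continuous.mul (by fun_prop) ?_)
      exact continuous_finsetSum _ fun i _ => (hxc i).mul (continuous_mulVec_apply P hxc i)
    · intro t ht
      have h0 : 0 ≤ t := hτ0.le.trans ht.1.le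
      have h1 : HasDerivAt (fun t => Real.exp (2 * α * t)) (Real.exp (2 * α * t) * (2 * α)) t := by
        simpa using ((hasDerivAt_id t).const_mul (2 * α)).exp
      exact (h1.hasDerivWithinAt.mul (hasDerivWithinAt_quadratic hP (hxd t h0))).mono
        Ioi_subset_Ici_self
    · refine (intervalIntegrable_iff_integrableOn_Icc_of_le hT).1
        (LocBdd.intervalIntegrable ?_ τ T)
      exact ((((((LocBdd.const _).mul bI₀).add ((LocBdd.const _).mul bI₁)).add
        ((LocBdd.const _).mul bI₂)).add ((LocBdd.const _).mul bJ₁)).add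
        ((LocBdd.const _).mul bJ₂)).add ((LocBdd.const _).mul bJ₃)
    · intro t ht
      have := mul_le_mul_of_nonneg_left (dissipation_le (y := y) (dy := dy) hh hσ hω hP hΨ ht.1.le)
        (Real.exp_pos (2 * α * t)).le
      refine (le_trans (le_of_eq ?_) this).trans (le_of_eq ?_)
      · ring
      · simp only [hI₀, hI₁, hI₂, hJ₁, hJ₂, hJ₃, hc₀, hc₁, hc₂, hd₂, hd₃]
        ring
  have int : ∀ (c : ℝ) (F : ℝ → ℝ), LocBdd F →
      IntervalIntegrable (fun t => c * F t) volume τ T := fun c F hF =>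
    ((LocBdd.const c).mul hF).intervalIntegrable _ _
  rw [intervalIntegral.integral_add (((((int _ _ bI₀).add (int _ _ bI₁)).add
      (int _ _ bI₂)).add (int _ _ bJ₁)).add (int _ _ bJ₂)) (int _ _ bJ₃),
    intervalIntegral.integral_add ((((int _ _ bI₀).add (int _ _ bI₁)).add
      (int _ _ bI₂)).add (int _ _ bJ₁)) (int _ _ bJ₂),
    intervalIntegral.integral_add (((int _ _ bI₀).add (int _ _ bI₁)).add
      (int _ _ bI₂)) (int _ _ bJ₁),
    intervalIntegral.integral_add ((int _ _ bI₀).add (int _ _ bI₁)) (int _ _ bI₂),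
    intervalIntegral.integral_add (int _ _ bI₀) (int _ _ bI₁)] at step1
  simp only [intervalIntegral.integral_const_mul] at step1
  -- the three integral inequalities
  have step2 : Real.pi ^ 2 / 4 * ∫ t in τ..T, J₁ t ≤ c₁ * ∫ t in τ..T, I₁ t :=
    integral_quadratic_sampling_error_le hS hh hα hxc hwb hxd q hT
  have step3 : d₂ * ∫ t in τ..T, J₂ t ≤ c₀ * ∫ t in (0 : ℝ)..T, I₀ t := by
    have h1 : ∫ t in τ..T, J₂ t = Real.exp (2 * α * τ) * ∫ t in (0 : ℝ)..(T - τ),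
        Real.exp (2 * α * t) * (y t - y ((⌊t / h⌋₊ : ℝ) * h)) ^ 2 := by
      have := intervalIntegral.integral_comp_sub_right (a := τ) (b := T) (fun t =>
        Real.exp (2 * α * t) * (y t - y ((⌊t / h⌋₊ : ℝ) * h)) ^ 2) τ
      rw [sub_self] at this
      rw [← this, ← intervalIntegral.integral_const_mul]
      refine intervalIntegral.integral_congr fun t ht => ?_
      rw [uIcc_of_le hT] at ht
      have e1 : Real.exp (2 * α * t) = Real.exp (2 * α * τ) * Real.exp (2 * α * (t - τ)) := by
        rw [← Real.exp_add]; ring_nf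
      have e2 : ⌊(t - τ) / h⌋₊ = ⌊t / h⌋₊ - q := by
        rw [hτ, sub_div, mul_div_cancel_right₀ _ hh.ne', Nat.floor_sub_natCast]
      have e3 : q ≤ ⌊t / h⌋₊ := Nat.le_floor ((le_div_iff₀ hh).2 ht.1)
      have e4 : ((⌊t / h⌋₊ - q : ℕ) : ℝ) * h = (⌊t / h⌋₊ : ℝ) * h - τ := by
        rw [Nat.cast_sub e3, sub_mul]
      simp only [hJ₂, e1, e2, e4]
      ring
    have h2 := integral_sampling_error_le hh hα hy (LocBdd.of_continuous hdy)
      (fun t ht => hs.hasDeriv_y_right ht) 0 (T := T - τ) (by simpa using hT)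
    rw [Nat.cast_zero, zero_mul] at h2
    have h3 : ∫ t in (0 : ℝ)..(T - τ), I₀ t ≤ ∫ t in (0 : ℝ)..T, I₀ t :=
      intervalIntegral.integral_mono_interval le_rfl (by linarith) (by linarith)
        (.of_forall nI₀) (bI₀.intervalIntegrable _ _)
    have h4 : Real.exp (-2 * α * τ) * Real.exp (2 * α * τ) = 1 := by
      rw [← Real.exp_add]; ring_nf; exact Real.exp_zero
    rw [h1]
    have hc₁0 : 0 ≤ c₁ := by positivity
    calc _ = W * kd ^ 2 * (Real.exp (-2 * α * τ) * Real.exp (2 * α * τ)) * (Real.pi ^ 2 / 4 *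
          ∫ t in (0 : ℝ)..(T - τ),
            Real.exp (2 * α * t) * (y t - y ((⌊t / h⌋₊ : ℝ) * h)) ^ 2) := by rw [hd₂]; ring
      _ ≤ W * kd ^ 2 * (c₁ * ∫ t in (0 : ℝ)..T, I₀ t) := by
        rw [h4, mul_one]
        exact mul_le_mul_of_nonneg_left (h2.trans (mul_le_mul_of_nonneg_left h3 hc₁0)) hWk
      _ = _ := by rw [hc₀]; ring
  have step4 : d₃ * ∫ t in τ..T, J₃ t ≤ c₂ * ∫ t in (0 : ℝ)..T, I₂ t := by
    have h1 := integral_difference_error_le hτ0 hT hα hy hdy haccb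
      (fun t ht => hs.hasDeriv_y_right ht) (fun t ht => hs.hasDeriv_dy_right hh ht)
    have h2 := mul_le_mul_of_nonneg_left h1 hRk
    rw [hd₃, hc₂]
    linarith
  rw [← intervalIntegral.integral_add_adjacent_intervals (bI₀.intervalIntegrable 0 τ)
    (bI₀.intervalIntegrable τ T)] at step3
  rw [← intervalIntegral.integral_add_adjacent_intervals (bI₂.intervalIntegrable 0 τ)
    (bI₂.intervalIntegrable τ T)] at step4
  linarith

theorem abs_eventAccel_le {C D t : ℝ} (hσ : 0 ≤ σ) (hσ1 : σ ≤ 1)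
    (hu : |sampledControl h q kp ki kd y ⌊t / h⌋₊| ≤ D) (hy : |y t| ≤ C) (hdy : |dy t| ≤ C) :
    |eventAccel a₁ a₂ b h q kp ki kd σ y dy t| ≤ 2 * |b| * D + (|a₁| + |a₂|) * C := by
  unfold eventAccel
  have h1 := (abs_eventControl_le hσ hσ1 (sampledControl h q kp ki kd y) ⌊t / h⌋₊).trans
    (mul_le_mul_of_nonneg_left hu zero_le_two)
  have h2 := mul_le_mul_of_nonneg_left h1 (abs_nonneg b)
  have h3 := mul_le_mul_of_nonneg_left hdy (abs_nonneg a₁)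
  have h4 := mul_le_mul_of_nonneg_left hy (abs_nonneg a₂)
  rw [← abs_mul] at h2 h3 h4
  have h5 := abs_sub (b * eventControl σ (sampledControl h q kp ki kd y) ⌊t / h⌋₊ - a₁ * dy t)
    (a₂ * y t)
  have h6 := abs_sub (b * eventControl σ (sampledControl h q kp ki kd y) ⌊t / h⌋₊) (a₁ * dy t)
  linarith

/-- On bounded time intervals, the whole state and its right derivative are bounded in terms of
the initial state. -/
theorem exists_state_bound (a₁ a₂ b : ℝ) (hh : 0 < h) (q : ℕ) (kp ki kd : ℝ) (hσ : 0 ≤ σ)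
    (hσ1 : σ ≤ 1) (N : ℕ) : ∃ C, 0 ≤ C ∧ ∀ y dy : ℝ → ℝ,
      IsEventSolution a₁ a₂ b h q kp ki kd σ y dy → ∀ t, 0 ≤ t → t ≤ N * h →
        |y t| ≤ C * (|y 0| + |dy 0|) ∧ |dy t| ≤ C * (|y 0| + |dy 0|) ∧
        |integralState h y t| ≤ C * (|y 0| + |dy 0|) ∧
        |eventAccel a₁ a₂ b h q kp ki kd σ y dy t| ≤ C * (|y 0| + |dy 0|) := by
  obtain ⟨C, hC0, hC⟩ := exists_growth_bound a₁ a₂ b hh q kp ki kd hσ hσ1 N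
  set D := (|kp| + |ki| * h * N + |kd|) * C with hD
  have hD0 : 0 ≤ D := by positivity
  set E := 2 * |b| * D + (|a₁| + |a₂|) * C with hE
  have hE0 : 0 ≤ E := by positivity
  have hF0 : 0 ≤ N * h * C := by positivity
  refine ⟨C + N * h * C + E, by positivity, fun y dy hs t h0 h1 => ?_⟩
  set r := |y 0| + |dy 0| with hr
  have hr0 : 0 ≤ r := by positivity
  have hCr : 0 ≤ C * r := by positivity
  have hEr : 0 ≤ E * r := by positivity
  have hFr : 0 ≤ N * h * C * r := by positivity
  obtain ⟨b1, b2⟩ := hC y dy hs t h0 h1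
  have hm := mem_grid hh h0
  have b3 : |integralState h y t| ≤ C * r * |t - 0| := by
    refine intervalIntegral.norm_integral_le_of_norm_le_const
      (f := fun s => y ((⌊s / h⌋₊ : ℝ) * h)) fun s hs' => ?_
    rw [uIoc_of_le h0] at hs'
    have hms := mem_grid hh hs'.1.le
    exact (hC y dy hs _ (by positivity) (hms.1.trans (hs'.2.trans h1))).1
  rw [sub_zero, abs_of_nonneg h0] at b3
  have b4 : |eventAccel a₁ a₂ b h q kp ki kd σ y dy t| ≤
      2 * |b| * (D * r) + (|a₁| + |a₂|) * (C * r) := by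
    refine abs_eventAccel_le hσ hσ1 ?_ b1 b2
    have hN : (⌊t / h⌋₊ : ℝ) ≤ N := by
      have : ⌊t / h⌋₊ ≤ N := Nat.floor_le_of_le ((div_le_iff₀ hh).2 h1)
      exact_mod_cast this
    have := abs_sampledControl_le (q := q) (kp := kp) (ki := ki) (kd := kd) (y := y) hh.le ⌊t / h⌋₊
      (C := C * r) fun s hs0 hs1 => (hC y dy hs s hs0 (hs1.trans (hm.1.trans h1))).1
    refine this.trans ?_
    rw [hD, mul_assoc _ C r]
    refine mul_le_mul_of_nonneg_right ?_ hCr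
    have := mul_le_mul_of_nonneg_left hN (show 0 ≤ |ki| * h by positivity)
    linarith
  have b5 : C * r * t ≤ N * h * C * r := by nlinarith
  have b6 : 2 * |b| * (D * r) + (|a₁| + |a₂|) * (C * r) = E * r := by rw [hE]; ring
  have e : (C + N * h * C + E) * r = C * r + N * h * C * r + E * r := by ring
  rw [e]
  refine ⟨by linarith, by linarith, by linarith, by linarith⟩

theorem integral_exp_mul_sq_le {f : ℝ → ℝ} {α τ D : ℝ} (hα : 0 ≤ α) (hτ : 0 ≤ τ)
    (hf : ∀ t, 0 ≤ t → t ≤ τ → |f t| ≤ D) :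
    ∫ t in (0 : ℝ)..τ, Real.exp (2 * α * t) * f t ^ 2 ≤ Real.exp (2 * α * τ) * D ^ 2 * τ := by
  have := intervalIntegral.norm_integral_le_of_norm_le_const (a := 0) (b := τ)
    (f := fun t => Real.exp (2 * α * t) * f t ^ 2) (C := Real.exp (2 * α * τ) * D ^ 2) ?_
  · rw [sub_zero, abs_of_nonneg hτ] at this
    exact (le_abs_self _).trans this
  · intro t ht
    rw [uIoc_of_le hτ] at ht
    rw [Real.norm_of_nonneg (by positivity)]
    refine mul_le_mul (Real.exp_le_exp.2 (by nlinarith [ht.2])) ?_ (sq_nonneg _) (by positivity)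
    rw [← sq_abs]
    exact pow_le_pow_left₀ (abs_nonneg _) (hf t ht.1.le ht.2) 2

/-- The linear matrix inequality implies exponential stability. -/
theorem eventStabilizesFull_of_LMIFeasible {α : ℝ} (hh : 0 < h) (hq : 0 < q) (hσ : 0 ≤ σ)
    (hσ1 : σ < 1) (hα : 0 ≤ α) (hL : LMIFeasible a₁ a₂ b h q kp ki kd σ α) :
    EventStabilizesFull a₁ a₂ b h q kp ki kd σ α := by
  obtain ⟨P, S, W, R, ω, hP, hS, hW, hR, hω, hΨ⟩ := hL
  obtain ⟨C, hC0, hC⟩ := exists_state_bound a₁ a₂ b hh q kp ki kd hσ hσ1.le q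
  obtain ⟨c, hc0, hc⟩ := exists_coercive hP
  set τ : ℝ := q * h with hτ
  have hτ0 : 0 ≤ τ := by positivity
  set p := ∑ i, ∑ j, |P i j| with hp
  set K := Real.exp (2 * α * τ) * (p * C ^ 2) +
    W * kd ^ 2 * (h ^ 2 * Real.exp (2 * α * h)) * (Real.exp (2 * α * τ) * C ^ 2 * τ) +
    R * kd ^ 2 * τ ^ 2 * (Real.exp (2 * α * τ) * C ^ 2 * τ) with hK
  have hp0 : 0 ≤ p := by positivity
  have hK0 : 0 ≤ K := by positivity
  set M := √(K / c) + C * Real.exp (α * τ) with hM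
  refine eventStabilizesFull_of_bound hh (M := M) fun y dy hy hdy hs T hT => ?_
  set r := |y 0| + |dy 0| with hr
  have hr0 : 0 ≤ r := by positivity
  have hMr : ∀ z, |z| ≤ M * Real.exp (-α * T) * r ↔
      |z| ≤ √(K / c) * Real.exp (-α * T) * r
        + C * (Real.exp (α * τ) * Real.exp (-α * T)) * r := by
    intro z; rw [hM]; ring_nf
  have hM1 : 0 ≤ √(K / c) * Real.exp (-α * T) * r := by positivity
  have hM2 : 0 ≤ C * (Real.exp (α * τ) * Real.exp (-α * T)) * r := by positivity
  have hsI : sampledIntegral h y T = integralState h y T := sampledIntegral_eq_integral hh y hT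
  rw [hMr, hMr, hMr, hsI]
  rcases le_total T τ with hTτ | hTτ
  · have h1 : 1 ≤ Real.exp (α * τ) * Real.exp (-α * T) := by
      rw [← Real.exp_add]
      exact Real.one_le_exp (by nlinarith)
    have h2 : C * r ≤ C * (Real.exp (α * τ) * Real.exp (-α * T)) * r := by
      have := mul_le_mul_of_nonneg_left h1 (show 0 ≤ C * r by positivity)
      linarith
    obtain ⟨b1, b2, b3, -⟩ := hC y dy hs T hT hTτ
    exact ⟨by linarith, by linarith, by linarith⟩
  · have hV := lyapunov_le hh hq hα hσ hW hR hω hP.1 hS.posSemidef hΨ hy hdy hs hTτ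
    have i1 := integral_exp_mul_sq_le (f := dy) hα hτ0
      fun t h0 h1 => (hC y dy hs t h0 h1).2.1
    have i2 := integral_exp_mul_sq_le (f := eventAccel a₁ a₂ b h q kp ki kd σ y dy) hα hτ0
      fun t h0 h1 => (hC y dy hs t h0 h1).2.2.2
    have i3 : stateVec h y dy τ ⬝ᵥ (P *ᵥ stateVec h y dy τ) ≤ p * (C * r) ^ 2 := by
      refine quadratic_le P fun i => ?_
      obtain ⟨b1, b2, b3, -⟩ := hC y dy hs τ hτ0 le_rfl
      fin_cases i
      exacts [b1, b2, b3]
    have i4 : Real.exp (2 * α * T) * (stateVec h y dy T ⬝ᵥ (P *ᵥ stateVec h y dy T)) ≤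
        K * r ^ 2 := by
      refine hV.trans ?_
      have j1 := mul_le_mul_of_nonneg_left i3 (Real.exp_pos (2 * α * τ)).le
      have j2 := mul_le_mul_of_nonneg_left i1
        (show 0 ≤ W * kd ^ 2 * (h ^ 2 * Real.exp (2 * α * h)) by positivity)
      have j3 := mul_le_mul_of_nonneg_left i2 (show 0 ≤ R * kd ^ 2 * τ ^ 2 by positivity)
      refine (add_le_add (add_le_add j1 j2) j3).trans (le_of_eq ?_)
      rw [hK]; ring
    have fin : ∀ i, |stateVec h y dy T i| ≤ √(K / c) * Real.exp (-α * T) * r := by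
      intro i
      refine abs_le_of_sq_le_sq ?_ hM1
      have e1 : Real.exp (-α * T) ^ 2 * Real.exp (2 * α * T) = 1 := by
        rw [← Real.exp_nat_mul, ← Real.exp_add]
        push_cast
        ring_nf
        exact Real.exp_zero
      have e2 := (mul_le_mul_of_nonneg_left (hc (stateVec h y dy T) i)
        (Real.exp_pos (2 * α * T)).le).trans i4
      have e3 := mul_le_mul_of_nonneg_left e2 (sq_nonneg (Real.exp (-α * T)))
      rw [mul_pow, mul_pow, Real.sq_sqrt (by positivity), div_mul_eq_mul_div, div_mul_eq_mul_div,
        le_div_iff₀ hc0]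
      linear_combination e3 + c * stateVec h y dy T i ^ 2 * (-e1)
    have f0 := fin 0
    have f1 := fin 1
    have f2 := fin 2
    change |y T| ≤ _ at f0
    change |dy T| ≤ _ at f1
    change |integralState h y T| ≤ _ at f2
    exact ⟨by linarith, by linarith, by linarith⟩

end LMI

section SmallGain

/-! ### Perturbed linear systems -/

variable {E : Type*} [NormedAddCommGroup E] [NormedSpace ℝ E]

/-- The semigroup generated by `A` decays like `M e^{-β t}`. -/
def SemigroupDecays (A : E →L[ℝ] E) (M β : ℝ) : Prop :=
  ∀ t : ℝ, 0 ≤ t → ∀ v : E, ‖NormedSpace.exp (t • A) v‖ ≤ M * Real.exp (-β * t) * ‖v‖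

theorem hasDerivAt_exp_smul_apply [CompleteSpace E] (A : E →L[ℝ] E) (v : E) (t : ℝ) :
    HasDerivAt (fun t : ℝ => NormedSpace.exp (t • A) v) (A (NormedSpace.exp (t • A) v)) t := by
  have h := hasDerivAt_exp_smul_const' A t
  exact h.clm_apply (hasDerivAt_const t v) |>.congr_deriv (by simp)

theorem exp_smul_apply_comm (A : E →L[ℝ] E) (v : E) (t : ℝ) :
    NormedSpace.exp (t • A) (A v) = A (NormedSpace.exp (t • A) v) := by
  have h : Commute (t • A) A := (Commute.refl A).smul_left t
  exact congrArg (fun L : E →L[ℝ] E => L v) h.exp_left.eq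

theorem norm_le_of_perturbed_linear [CompleteSpace E] {A : E →L[ℝ] E} {M α β η t₀ T : ℝ}
    (hM : 0 ≤ M) (hη : 0 ≤ η) (hαβ : α < β) (hA : SemigroupDecays A M β) (hT : t₀ ≤ T)
    {X d : ℝ → E} (hX : ContinuousOn X (Icc t₀ T))
    (hX' : ∀ t ∈ Ico t₀ T, HasDerivWithinAt X (A (X t) + d t) (Ici t) t)
    (hd : ∀ t ∈ Ico t₀ T, ‖d t‖ ≤ η * Real.exp (-α * t)) :
    ‖X T‖ ≤ M * Real.exp (-β * (T - t₀)) * ‖X t₀‖ + M * η / (β - α) * Real.exp (-α * T) := by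
  have hδ : 0 < β - α := sub_pos.2 hαβ
  have hexp : ∀ t, HasDerivAt (fun s : ℝ => NormedSpace.exp ((T - s) • A))
      (-(NormedSpace.exp ((T - t) • A) * A)) t := by
    intro t
    have h1 := (hasDerivAt_exp_smul_const A (T - t)).scomp t ((hasDerivAt_id t).const_sub T)
    exact h1.congr_deriv (by simp)
  set c := M * η / (β - α) * Real.exp (-β * T) with hc
  have key := image_norm_le_of_norm_deriv_right_le_deriv_boundary
    (f := fun s => NormedSpace.exp ((T - s) • A) (X s))
    (f' := fun s => NormedSpace.exp ((T - s) • A) (d s)) (a := t₀) (b := T)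
    (B := fun s => ‖NormedSpace.exp ((T - t₀) • A) (X t₀)‖ +
      c * (Real.exp ((β - α) * s) - Real.exp ((β - α) * t₀)))
    (B' := fun s => c * (Real.exp ((β - α) * s) * (β - α))) ?_ ?_ ?_ ?_ ?_
    (right_mem_Icc.2 hT)
  · simp only [sub_self, zero_smul, NormedSpace.exp_zero] at key
    change ‖X T‖ ≤ _ at key
    have h1 := hA (T - t₀) (by linarith) (X t₀)
    have hc0 : 0 ≤ c := by positivity
    have h2 : c * (Real.exp ((β - α) * T) - Real.exp ((β - α) * t₀)) ≤
        M * η / (β - α) * Real.exp (-α * T) := by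
      have e : Real.exp (-β * T) * Real.exp ((β - α) * T) = Real.exp (-α * T) := by
        rw [← Real.exp_add]; ring_nf
      have : 0 ≤ c * Real.exp ((β - α) * t₀) := by positivity
      calc _ ≤ c * Real.exp ((β - α) * T) := by linarith
        _ = M * η / (β - α) * (Real.exp (-β * T) * Real.exp ((β - α) * T)) := by rw [hc]; ring
        _ = _ := by rw [e]
    linarith
  · refine ContinuousOn.clm_apply ?_ hX
    exact fun t _ => (hexp t).continuousAt.continuousWithinAt
  · intro t ht
    refine ((hexp t).hasDerivWithinAt.clm_apply (hX' t ht)).congr_deriv ?_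
    simp
  · simp
  · intro s
    have : HasDerivAt (fun s => Real.exp ((β - α) * s))
        (Real.exp ((β - α) * s) * (β - α)) s := by
      simpa using ((hasDerivAt_id s).const_mul (β - α)).exp
    exact ((this.sub_const _).const_mul c).const_add _
  · intro t ht
    refine (hA (T - t) (by linarith [ht.2]) (d t)).trans ?_
    have e : Real.exp (-β * (T - t)) * Real.exp (-α * t) =
        Real.exp (-β * T) * Real.exp ((β - α) * t) := by
      rw [← Real.exp_add, ← Real.exp_add]; ring_nf
    calc _ ≤ M * Real.exp (-β * (T - t)) * (η * Real.exp (-α * t)) :=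
          mul_le_mul_of_nonneg_left (hd t ht) (by positivity)
      _ = M * η * (Real.exp (-β * (T - t)) * Real.exp (-α * t)) := by ring
      _ = _ := by rw [e, hc]; field_simp

/-- A small-gain theorem: a small perturbation which may depend on the past keeps almost the whole
decay rate of a linear system. -/
theorem norm_le_of_small_gain [CompleteSpace E] {A : E →L[ℝ] E} {M α β ε t₀ D : ℝ}
    (hM : 0 ≤ M) (hα : 0 ≤ α) (hαβ : α < β) (hA : SemigroupDecays A M β) (hε : 0 ≤ ε)
    (hMε : M * ε / (β - α) ≤ 1 / 2) (ht₀ : 0 ≤ t₀) {X d : ℝ → E} (hX : ContinuousOn X (Ici 0))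
    (hX' : ∀ t, t₀ ≤ t → HasDerivWithinAt X (A (X t) + d t) (Ici t) t)
    (hd : ∀ T Z : ℝ, 0 ≤ Z → (∀ s, 0 ≤ s → s ≤ T → ‖X s‖ ≤ Z * Real.exp (-α * s)) →
      ∀ t, t₀ ≤ t → t ≤ T → ‖d t‖ ≤ ε * Z * Real.exp (-α * t))
    (hD : ∀ s, 0 ≤ s → s ≤ t₀ → ‖X s‖ ≤ D) {T : ℝ} (hT : 0 ≤ T) :
    ‖X T‖ ≤ (2 * M + 1) * Real.exp (α * t₀) * D * Real.exp (-α * T) := by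
  have hD0 : 0 ≤ D := (norm_nonneg _).trans (hD 0 le_rfl ht₀)
  have hinv : ∀ s, Real.exp (α * s) * Real.exp (-α * s) = 1 := fun s => by
    rw [← Real.exp_add]; ring_nf; exact Real.exp_zero
  have hcont : ContinuousOn (fun s => Real.exp (α * s) * ‖X s‖) (Icc 0 T) :=
    ContinuousOn.mul (by fun_prop) (hX.mono Icc_subset_Ici_self).norm
  obtain ⟨s, hs, hmax⟩ := isCompact_Icc.exists_isMaxOn (nonempty_Icc.2 hT) hcont
  set Z := Real.exp (α * s) * ‖X s‖ with hZ
  have hZ0 : 0 ≤ Z := by positivity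
  have hXZ : ∀ r, 0 ≤ r → r ≤ T → ‖X r‖ ≤ Z * Real.exp (-α * r) := by
    intro r h0 h1
    have h2 : Real.exp (α * r) * ‖X r‖ ≤ Z := hmax ⟨h0, h1⟩
    have h3 := mul_le_mul_of_nonneg_right h2 (Real.exp_pos (-α * r)).le
    calc ‖X r‖ = Real.exp (α * r) * Real.exp (-α * r) * ‖X r‖ := by rw [hinv, one_mul]
      _ = Real.exp (α * r) * ‖X r‖ * Real.exp (-α * r) := by ring
      _ ≤ _ := h3
  suffices hbound : Z ≤ (2 * M + 1) * Real.exp (α * t₀) * D from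
    (hXZ T hT le_rfl).trans (mul_le_mul_of_nonneg_right hbound (Real.exp_pos _).le)
  have hp1 : 0 ≤ Real.exp (α * t₀) * D := by positivity
  have hp2 : 0 ≤ M * (Real.exp (α * t₀) * D) := by positivity
  rcases le_total s t₀ with hst | hst
  · have h1 : Z ≤ Real.exp (α * t₀) * D :=
      mul_le_mul (Real.exp_le_exp.2 (mul_le_mul_of_nonneg_left hst hα)) (hD s hs.1 hst)
        (norm_nonneg _) (Real.exp_pos _).le
    linarith
  · have h1 := norm_le_of_perturbed_linear (α := α) (η := ε * Z) hM (by positivity) hαβ hA hst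
      (hX.mono fun r hr => ht₀.trans hr.1) (fun t ht => hX' t ht.1)
      (fun t ht => hd T Z hZ0 hXZ t ht.1 (ht.2.le.trans hs.2))
    have h2 := mul_le_mul_of_nonneg_left h1 (Real.exp_pos (α * s)).le
    have h3 : Real.exp (α * s) * Real.exp (-β * (s - t₀)) ≤ Real.exp (α * t₀) := by
      rw [← Real.exp_add]
      exact Real.exp_le_exp.2 (by nlinarith)
    have h4 : Real.exp (α * s) * Real.exp (-β * (s - t₀)) * (M * ‖X t₀‖) ≤
        Real.exp (α * t₀) * (M * D) :=
      mul_le_mul h3 (mul_le_mul_of_nonneg_left (hD t₀ ht₀ le_rfl) hM) (by positivity)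
        (by positivity)
    have h5 : Real.exp (α * s) * (M * (ε * Z) / (β - α) * Real.exp (-α * s)) =
        M * ε / (β - α) * Z := by
      linear_combination M * (ε * Z) / (β - α) * hinv s
    have h6 := mul_le_mul_of_nonneg_right hMε hZ0
    have h7 : Z ≤ Real.exp (α * s) * Real.exp (-β * (s - t₀)) * (M * ‖X t₀‖) +
        Real.exp (α * s) * (M * (ε * Z) / (β - α) * Real.exp (-α * s)) := by
      rw [hZ]; linarith
    linarith

end SmallGain

section Continuous

/-! ### The continuous closed loop -/

variable {a₁ a₂ b kp ki kd β : ℝ} {y dy : ℝ → ℝ}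

theorem PIDStabilizes.exists_bound (H : PIDStabilizes a₁ a₂ b kp ki kd β) :
    ∃ M, 0 ≤ M ∧ ∀ y dy : ℝ → ℝ, IsPIDSolution a₁ a₂ b kp ki kd y dy → ∀ t, 0 ≤ t →
      |y t| ≤ M * Real.exp (-β * t) * (|y 0| + |dy 0|) ∧
      |dy t| ≤ M * Real.exp (-β * t) * (|y 0| + |dy 0|) := by
  obtain ⟨M, hM⟩ := H
  refine ⟨|M|, abs_nonneg M, fun y dy hs t ht => ?_⟩
  have b1 := abs_apply_le_norm !₂[y t, dy t] 0
  have b2 := abs_apply_le_norm !₂[y t, dy t] 1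
  simp only [Matrix.cons_val_zero, Matrix.cons_val_one] at b1 b2
  have hb := (hM y dy hs t ht).trans (mul_le_mul (mul_le_mul_of_nonneg_right (le_abs_self M)
    (Real.exp_pos (-β * t)).le) (norm_vec2_le (y 0) (dy 0)) (norm_nonneg _) (by positivity))
  exact ⟨b1.trans hb, b2.trans hb⟩

theorem PIDStabilizesFull.exists_bound (H : PIDStabilizesFull a₁ a₂ b kp ki kd β) :
    ∃ M, 0 ≤ M ∧ ∀ y dy : ℝ → ℝ, IsPIDSolution a₁ a₂ b kp ki kd y dy → ∀ t, 0 ≤ t →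
      |y t| ≤ M * Real.exp (-β * t) * (|y 0| + |dy 0|) ∧
      |dy t| ≤ M * Real.exp (-β * t) * (|y 0| + |dy 0|) ∧
      |∫ s in (0 : ℝ)..t, y s| ≤ M * Real.exp (-β * t) * (|y 0| + |dy 0|) := by
  obtain ⟨M, hM⟩ := H
  refine ⟨|M|, abs_nonneg M, fun y dy hs t ht => ?_⟩
  have b1 := abs_apply_le_norm !₂[y t, dy t, ∫ s in (0 : ℝ)..t, y s] 0
  have b2 := abs_apply_le_norm !₂[y t, dy t, ∫ s in (0 : ℝ)..t, y s] 1
  have b3 := abs_apply_le_norm !₂[y t, dy t, ∫ s in (0 : ℝ)..t, y s] 2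
  have h0 := norm_vec3_le (y 0) (dy 0) (∫ s in (0 : ℝ)..0, y s)
  have hb := (hM y dy hs t ht).trans (mul_le_mul (mul_le_mul_of_nonneg_right (le_abs_self M)
    (Real.exp_pos (-β * t)).le) h0 (norm_nonneg _) (by positivity))
  rw [intervalIntegral.integral_same, abs_zero, add_zero] at hb
  exact ⟨b1.trans hb, b2.trans hb, b3.trans hb⟩

theorem IsPIDSolution.continuousOn_y (hs : IsPIDSolution a₁ a₂ b kp ki kd y dy) :
    ContinuousOn y (Ici 0) := fun t ht => (hs.hasDeriv_y t ht).continuousWithinAt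

/-- If the integral acts on the plant, then the decay of the plant state entails that of the
integral state. -/
theorem exists_integral_bound (hb : b * ki ≠ 0) (hβ : 0 ≤ β)
    (H : PIDStabilizes a₁ a₂ b kp ki kd β) :
    ∃ M, 0 ≤ M ∧ ∀ y dy : ℝ → ℝ, IsPIDSolution a₁ a₂ b kp ki kd y dy → ∀ t, 0 ≤ t →
      |y t| ≤ M * Real.exp (-β * t) * (|y 0| + |dy 0|) ∧
      |dy t| ≤ M * Real.exp (-β * t) * (|y 0| + |dy 0|) ∧
      |∫ s in (0 : ℝ)..t, y s| ≤ M * Real.exp (-β * t) * (|y 0| + |dy 0|) := by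
  obtain ⟨M, hM0, hM⟩ := H.exists_bound
  set c := |b * kp - a₂| + |b * kd - a₁| + |b * ki| with hc
  have hbk : 0 < |b * ki| := abs_pos.2 hb
  refine ⟨M + (2 + c) * M / |b * ki|, by positivity, fun y dy hs t ht => ?_⟩
  obtain ⟨b1, b2⟩ := hM y dy hs t ht
  set r := |y 0| + |dy 0| with hr
  set N := M * Real.exp (-β * t) * r with hN
  have hN0 : 0 ≤ N := by positivity
  have hdec : ∀ s, t ≤ s → |y s| ≤ N ∧ |dy s| ≤ N := by
    intro s hs'
    obtain ⟨c1, c2⟩ := hM y dy hs s (ht.trans hs')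
    have : M * Real.exp (-β * s) * r ≤ N := by
      have h1 : Real.exp (-β * s) ≤ Real.exp (-β * t) := Real.exp_le_exp.2 (by nlinarith)
      exact mul_le_mul_of_nonneg_right (mul_le_mul_of_nonneg_left h1 hM0) (by positivity)
    exact ⟨c1.trans this, c2.trans this⟩
  set I := ∫ s in (0 : ℝ)..t, y s with hI
  have hyint : ∀ p s, 0 ≤ p → 0 ≤ s → IntervalIntegrable y volume p s := fun p s hp hs' =>
    (hs.continuousOn_y.mono fun x hx => (le_min hp hs').trans hx.1).intervalIntegrable
  have hIs : ∀ s, t ≤ s → s ≤ t + 1 → |(∫ p in (0 : ℝ)..s, y p) - I| ≤ N := by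
    intro s h1 h2
    rw [hI, intervalIntegral.integral_interval_sub_left (hyint _ _ le_rfl (ht.trans h1))
      (hyint _ _ le_rfl ht)]
    have := intervalIntegral.norm_integral_le_of_norm_le_const (a := t) (b := s) (f := y) (C := N)
      fun p hp => by
        rw [uIoc_of_le h1] at hp
        exact (hdec p hp.1.le).1
    refine this.trans ?_
    rw [abs_of_nonneg (by linarith)]
    nlinarith
  have key := norm_image_sub_le_of_norm_deriv_right_le_segment (a := t) (b := t + 1)
    (f := fun s => dy s - b * ki * I * s)
    (f' := fun s => b * pidControl kp ki kd y dy s - a₁ * dy s - a₂ * y s - b * ki * I)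
    (C := c * N) ?_ ?_ ?_ (t + 1) (right_mem_Icc.2 (by linarith))
  · rw [add_sub_cancel_left, mul_one, Real.norm_eq_abs] at key
    have e1 : dy (t + 1) - b * ki * I * (t + 1) - (dy t - b * ki * I * t) =
        dy (t + 1) - dy t - b * ki * I := by ring
    rw [e1] at key
    have h2 := (hdec (t + 1) (by linarith)).2
    have h3 : |b * ki| * |I| ≤ (2 + c) * N := by
      rw [← abs_mul]
      rw [abs_le] at key h2 b2 ⊢
      constructor <;> linarith
    have h4 : |I| ≤ (2 + c) * N / |b * ki| := (le_div_iff₀' hbk).2 h3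
    have e2 : (M + (2 + c) * M / |b * ki|) * Real.exp (-β * t) * r =
        N + (2 + c) * N / |b * ki| := by rw [hN]; ring
    have h5 : 0 ≤ (2 + c) * N / |b * ki| := by positivity
    rw [e2]
    exact ⟨by linarith, by linarith, by linarith⟩
  · refine ContinuousOn.sub (fun s hs' => ?_) (by fun_prop)
    exact ((hs.hasDeriv_dy s (ht.trans hs'.1)).mono
      fun x hx => ht.trans hx.1).continuousWithinAt
  · intro s hs'
    have h0 : 0 ≤ s := ht.trans hs'.1
    refine (((hs.hasDeriv_dy s h0).mono (Ici_subset_Ici.2 h0)).sub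
      ((hasDerivAt_id s).const_mul (b * ki * I)).hasDerivWithinAt).congr_deriv ?_
    simp
  · intro s hs'
    obtain ⟨c1, c2⟩ := hdec s hs'.1
    have c3 := hIs s hs'.1 hs'.2.le
    have e : b * pidControl kp ki kd y dy s - a₁ * dy s - a₂ * y s - b * ki * I =
        (b * kp - a₂) * y s + (b * kd - a₁) * dy s
          + b * ki * ((∫ p in (0 : ℝ)..s, y p) - I) := by
      unfold pidControl; ring
    rw [e]
    refine (norm_add₃_le).trans ?_
    simp only [Real.norm_eq_abs, abs_mul (b * kp - a₂), abs_mul (b * kd - a₁), abs_mul (b * ki)]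
    have d1 := mul_le_mul_of_nonneg_left c1 (abs_nonneg (b * kp - a₂))
    have d2 := mul_le_mul_of_nonneg_left c2 (abs_nonneg (b * kd - a₁))
    have d3 := mul_le_mul_of_nonneg_left c3 (abs_nonneg (b * ki))
    rw [hc]
    linarith

/-! ### The closed-loop generators -/

open ContinuousLinearMap in
/-- The generator of the plant under PD control. -/
noncomputable def generatorPD (a₁ a₂ b kp kd : ℝ) : (ℝ × ℝ) →L[ℝ] (ℝ × ℝ) :=
  (snd ℝ ℝ ℝ).prod ((b * kp - a₂) • fst ℝ ℝ ℝ + (b * kd - a₁) • snd ℝ ℝ ℝ)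

theorem generatorPD_apply (a₁ a₂ b kp kd : ℝ) (v : ℝ × ℝ) :
    generatorPD a₁ a₂ b kp kd v = (v.2, (b * kp - a₂) * v.1 + (b * kd - a₁) * v.2) := rfl

open ContinuousLinearMap in
/-- The generator of the plant and the integrator under PID control. -/
noncomputable def generatorPID (a₁ a₂ b kp ki kd : ℝ) : (ℝ × ℝ × ℝ) →L[ℝ] (ℝ × ℝ × ℝ) :=
  ((fst ℝ ℝ ℝ).comp (snd ℝ ℝ (ℝ × ℝ))).prod
    (((b * kp - a₂) • fst ℝ ℝ (ℝ × ℝ) + (b * kd - a₁) • (fst ℝ ℝ ℝ).comp (snd ℝ ℝ (ℝ × ℝ))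
      + (b * ki) • (snd ℝ ℝ ℝ).comp (snd ℝ ℝ (ℝ × ℝ))).prod (fst ℝ ℝ (ℝ × ℝ)))

theorem generatorPID_apply (a₁ a₂ b kp ki kd : ℝ) (v : ℝ × ℝ × ℝ) :
    generatorPID a₁ a₂ b kp ki kd v = (v.2.1,
      (b * kp - a₂) * v.1 + (b * kd - a₁) * v.2.1 + b * ki * v.2.2, v.1) := rfl

theorem hasDerivAt_fst_comp {E F : Type*} [NormedAddCommGroup E] [NormedSpace ℝ E]
    [NormedAddCommGroup F] [NormedSpace ℝ F] {X : ℝ → E × F} {v : E × F} {t : ℝ}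
    (h : HasDerivAt X v t) : HasDerivAt (fun t => (X t).1) v.1 t :=
  (hasFDerivAt_fst (𝕜 := ℝ) (p := X t)).comp_hasDerivAt t h

theorem hasDerivAt_snd_comp {E F : Type*} [NormedAddCommGroup E] [NormedSpace ℝ E]
    [NormedAddCommGroup F] [NormedSpace ℝ F] {X : ℝ → E × F} {v : E × F} {t : ℝ}
    (h : HasDerivAt X v t) : HasDerivAt (fun t => (X t).2) v.2 t :=
  (hasFDerivAt_snd (𝕜 := ℝ) (p := X t)).comp_hasDerivAt t h

theorem semigroupDecays_generatorPD (hb : b * ki = 0) (H : PIDStabilizes a₁ a₂ b kp ki kd β) :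
    ∃ M, 0 ≤ M ∧ SemigroupDecays (generatorPD a₁ a₂ b kp kd) M β := by
  obtain ⟨M, hM0, hM⟩ := H.exists_bound
  refine ⟨M * 2, by positivity, fun t ht v => ?_⟩
  set X : ℝ → ℝ × ℝ := fun t => NormedSpace.exp (t • generatorPD a₁ a₂ b kp kd) v with hX
  have hX0 : X 0 = v := by simp [hX]
  have hd : ∀ t, HasDerivAt X (generatorPD a₁ a₂ b kp kd (X t)) t :=
    hasDerivAt_exp_smul_apply _ v
  have hs : IsPIDSolution a₁ a₂ b kp ki kd (fun t => (X t).1) (fun t => (X t).2) := by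
    constructor
    · intro t _
      exact (hasDerivAt_fst_comp (hd t)).hasDerivWithinAt
    · intro t _
      refine (hasDerivAt_snd_comp (hd t)).hasDerivWithinAt.congr_deriv ?_
      rw [generatorPD_apply]
      simp only [pidControl]
      linear_combination (-∫ s in (0 : ℝ)..t, (X s).1) * hb
  obtain ⟨b1, b2⟩ := hM _ _ hs t ht
  simp only [hX0] at b1 b2
  have hv : |v.1| + |v.2| ≤ 2 * ‖v‖ := by
    have h1 : |v.1| ≤ ‖v‖ := norm_fst_le v
    have h2 : |v.2| ≤ ‖v‖ := norm_snd_le v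
    linarith
  have hfin : M * Real.exp (-β * t) * (|v.1| + |v.2|) ≤ M * 2 * Real.exp (-β * t) * ‖v‖ := by
    have := mul_le_mul_of_nonneg_left hv (show 0 ≤ M * Real.exp (-β * t) by positivity)
    linarith
  exact max_le (b1.trans hfin) (b2.trans hfin)

theorem semigroupDecays_generatorPID
    (H : ∃ M, 0 ≤ M ∧ ∀ y dy : ℝ → ℝ, IsPIDSolution a₁ a₂ b kp ki kd y dy → ∀ t, 0 ≤ t →
      |y t| ≤ M * Real.exp (-β * t) * (|y 0| + |dy 0|) ∧
      |dy t| ≤ M * Real.exp (-β * t) * (|y 0| + |dy 0|) ∧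
      |∫ s in (0 : ℝ)..t, y s| ≤ M * Real.exp (-β * t) * (|y 0| + |dy 0|)) :
    ∃ M, 0 ≤ M ∧ SemigroupDecays (generatorPID a₁ a₂ b kp ki kd) M β := by
  obtain ⟨M, hM0, hM⟩ := H
  set A := generatorPID a₁ a₂ b kp ki kd with hA
  have plane : ∀ p r t : ℝ, 0 ≤ t → ‖NormedSpace.exp (t • A) (p, r, (0 : ℝ))‖ ≤
      M * Real.exp (-β * t) * (|p| + |r|) := by
    intro p r t ht
    set X : ℝ → ℝ × ℝ × ℝ := fun t => NormedSpace.exp (t • A) (p, r, (0 : ℝ)) with hX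
    have hX0 : X 0 = (p, r, 0) := by simp [hX]
    have hd : ∀ t, HasDerivAt X (A (X t)) t := hasDerivAt_exp_smul_apply _ _
    have hXc : Continuous X := continuous_iff_continuousAt.2 fun t => (hd t).continuousAt
    have hI : ∀ t, ∫ s in (0 : ℝ)..t, (X s).1 = (X t).2.2 := by
      intro t
      have := intervalIntegral.integral_eq_sub_of_hasDerivAt (a := 0) (b := t)
        (f := fun t => (X t).2.2) (f' := fun t => (X t).1)
        (fun s _ => hasDerivAt_snd_comp (hasDerivAt_snd_comp (hd s))) (hXc.fst.intervalIntegrable _ _)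
      rw [this, hX0, sub_zero]
    have hs : IsPIDSolution a₁ a₂ b kp ki kd (fun t => (X t).1) (fun t => (X t).2.1) := by
      constructor
      · intro t _
        exact (hasDerivAt_fst_comp (hd t)).hasDerivWithinAt
      · intro t _
        refine (hasDerivAt_fst_comp (hasDerivAt_snd_comp (hd t))).hasDerivWithinAt.congr_deriv ?_
        rw [hA, generatorPID_apply]
        simp only [pidControl, hI]
        ring
    obtain ⟨b1, b2, b3⟩ := hM _ _ hs t ht
    simp only [hX0, hI] at b1 b2 b3
    exact max_le b1 (max_le b2 b3)
  set c := b * kp - a₂ with hc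
  set L := M * ‖A‖ + M * |c| with hL
  have hL0 : 0 ≤ L := by positivity
  have axis : ∀ t, 0 ≤ t → ‖NormedSpace.exp (t • A) ((0 : ℝ), (0 : ℝ), (1 : ℝ))‖ ≤
      L * Real.exp (-β * t) := by
    intro t ht
    have e1 : ((0 : ℝ), (0 : ℝ), (1 : ℝ)) = A (1, 0, 0) - c • ((0 : ℝ), (1 : ℝ), (0 : ℝ)) := by
      rw [hA, generatorPID_apply, hc]
      ext <;> simp
    rw [e1, map_sub, map_smul, exp_smul_apply_comm]
    refine (norm_sub_le _ _).trans ?_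
    have h1 := plane 1 0 t ht
    have h2 := plane 0 1 t ht
    simp only [abs_one, abs_zero, add_zero, zero_add, mul_one] at h1 h2
    have h3 := (A.le_opNorm (NormedSpace.exp (t • A) (1, 0, 0))).trans
      (mul_le_mul_of_nonneg_left h1 (norm_nonneg A))
    rw [norm_smul, Real.norm_eq_abs]
    have h4 := mul_le_mul_of_nonneg_left h2 (abs_nonneg c)
    rw [hL]
    linarith
  refine ⟨M * 2 + L, by positivity, fun t ht v => ?_⟩
  obtain ⟨p, r, z⟩ := v
  have e : ((p, r, z) : ℝ × ℝ × ℝ) = (p, r, 0) + z • ((0 : ℝ), (0 : ℝ), (1 : ℝ)) := by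
    ext <;> simp
  have hp : |p| ≤ ‖((p, r, z) : ℝ × ℝ × ℝ)‖ := norm_fst_le (p, r, z)
  have hr : |r| ≤ ‖((p, r, z) : ℝ × ℝ × ℝ)‖ :=
    (norm_fst_le (r, z)).trans (norm_snd_le (p, r, z))
  have hz : |z| ≤ ‖((p, r, z) : ℝ × ℝ × ℝ)‖ :=
    (norm_snd_le (r, z)).trans (norm_snd_le (p, r, z))
  set n := ‖((p, r, z) : ℝ × ℝ × ℝ)‖
  rw [e, map_add, map_smul]
  refine (norm_add_le _ _).trans ?_
  rw [norm_smul, Real.norm_eq_abs]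
  have h1 := (plane p r t ht).trans (mul_le_mul_of_nonneg_left (add_le_add hp hr)
    (show 0 ≤ M * Real.exp (-β * t) by positivity))
  have h2 := mul_le_mul hz (axis t ht) (norm_nonneg _) ((abs_nonneg z).trans hz)
  linarith

end Continuous

section Perturbation

/-! ### The event-triggered control as a perturbation of the continuous one -/

variable {a₁ a₂ b h kp ki kd σ α κ T Z : ℝ} {q : ℕ} {y dy : ℝ → ℝ}

theorem exp_neg_mul_le_shift {c s t : ℝ} (hα : 0 ≤ α) (hst : t - c ≤ s) :
    Real.exp (-α * s) ≤ Real.exp (α * c) * Real.exp (-α * t) := by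
  rw [← Real.exp_add]
  exact Real.exp_le_exp.2 (by nlinarith)

theorem IsEventSolution.abs_sub_le (hs : IsEventSolution a₁ a₂ b h q kp ki kd σ y dy) {r s : ℝ}
    (hr : 0 ≤ r) (hrs : r ≤ s) (hsT : s ≤ T) (hα : 0 ≤ α) (hZ : 0 ≤ Z)
    (hdy : ∀ s, 0 ≤ s → s ≤ T → |dy s| ≤ Z * Real.exp (-α * s)) :
    |y s - y r| ≤ (s - r) * (Z * Real.exp (-α * r)) := by
  have := norm_image_sub_le_of_norm_deriv_right_le_segment (f := y) (f' := dy) (a := r) (b := s)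
    (C := Z * Real.exp (-α * r)) (hs.continuousOn_y.mono fun x hx => hr.trans hx.1)
    (fun x hx => hs.hasDeriv_y_right (hr.trans hx.1)) (fun x hx =>
      (hdy x (hr.trans hx.1) (hx.2.le.trans hsT)).trans (mul_le_mul_of_nonneg_left
        (Real.exp_le_exp.2 (by nlinarith [hx.1])) hZ)) s (right_mem_Icc.2 hrs)
  rwa [mul_comm] at this

/-- The sampled control is bounded by the decaying bound on the state. -/
theorem abs_sampledControl_le_of_decay (hh : 0 < h) (hq : 0 < q) (hq1 : q * h ≤ 1) (hα : 0 ≤ α)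
    (hZ : 0 ≤ Z)
    (hs : IsEventSolution a₁ a₂ b h q (kp + kd / (q * h)) ki (-(kd / (q * h))) σ y dy)
    (hy : ∀ s, 0 ≤ s → s ≤ T → |y s| ≤ Z * Real.exp (-α * s))
    (hdy : ∀ s, 0 ≤ s → s ≤ T → |dy s| ≤ Z * Real.exp (-α * s))
    (hI : ∀ s, 0 ≤ s → s ≤ T → |ki * integralState h y s| ≤ κ * Z * Real.exp (-α * s))
    {k : ℕ} (hk : q ≤ k) (hkT : k * h ≤ T) :
    |sampledControl h q (kp + kd / (q * h)) ki (-(kd / (q * h))) y k| ≤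
      (|kp| + |kd| * Real.exp α + κ) * (Z * Real.exp (-α * (k * h))) := by
  have hτ : 0 < q * h := by positivity
  have hk0 : 0 ≤ (k : ℝ) * h := by positivity
  have hkq : 0 ≤ (k : ℝ) * h - q * h := by
    rw [← sub_mul]
    exact mul_nonneg (sub_nonneg.2 (by exact_mod_cast hk)) hh.le
  rw [sampledControl_eq hh hk]
  set τ : ℝ := q * h with hτdef
  set t : ℝ := k * h with ht
  have e : (kp + kd / τ) * y t + ki * integralState h y t + -(kd / τ) * y (t - τ) =
      kp * y t + ki * integralState h y t + kd * ((y t - y (t - τ)) / τ) := by ring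
  rw [e]
  refine (abs_add_three _ _ _).trans ?_
  simp only [abs_mul kp, abs_mul kd]
  have h1 := mul_le_mul_of_nonneg_left (hy t hk0 hkT) (abs_nonneg kp)
  have h2 := hI t hk0 hkT
  have h3 : |(y t - y (t - τ)) / τ| ≤ Z * (Real.exp α * Real.exp (-α * t)) := by
    rw [abs_div, abs_of_pos hτ, div_le_iff₀ hτ]
    have h4 := hs.abs_sub_le (r := t - τ) (s := t) hkq (by linarith) hkT hα hZ hdy
    have h5 : Real.exp (-α * (t - τ)) ≤ Real.exp α * Real.exp (-α * t) := by
      have := exp_neg_mul_le_shift (c := 1) (s := t - τ) (t := t) hα (by linarith)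
      rwa [mul_one] at this
    have h6 := mul_le_mul_of_nonneg_left (mul_le_mul_of_nonneg_left h5 hZ) hτ.le
    linarith
  have h7 := mul_le_mul_of_nonneg_left h3 (abs_nonneg kd)
  linarith

/-- The second derivative is bounded by the decaying bound on the state. -/
theorem abs_eventAccel_le_of_decay (hh : 0 < h) (hh1 : h ≤ 1) (hq : 0 < q) (hq1 : q * h ≤ 1)
    (hα : 0 ≤ α) (hZ : 0 ≤ Z) (hκ : 0 ≤ κ) (hσ : 0 ≤ σ) (hσ1 : σ ≤ 1)
    (hs : IsEventSolution a₁ a₂ b h q (kp + kd / (q * h)) ki (-(kd / (q * h))) σ y dy)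
    (hy : ∀ s, 0 ≤ s → s ≤ T → |y s| ≤ Z * Real.exp (-α * s))
    (hdy : ∀ s, 0 ≤ s → s ≤ T → |dy s| ≤ Z * Real.exp (-α * s))
    (hI : ∀ s, 0 ≤ s → s ≤ T → |ki * integralState h y s| ≤ κ * Z * Real.exp (-α * s))
    {t : ℝ} (ht : q * h ≤ t) (htT : t ≤ T) :
    |eventAccel a₁ a₂ b h q (kp + kd / (q * h)) ki (-(kd / (q * h))) σ y dy t| ≤
      (2 * |b| * ((|kp| + |kd| * Real.exp α + κ) * Real.exp α) + |a₁| + |a₂|) *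
        (Z * Real.exp (-α * t)) := by
  have h0 : 0 ≤ t := le_trans (by positivity) ht
  have hk : q ≤ ⌊t / h⌋₊ := Nat.le_floor ((le_div_iff₀ hh).2 ht)
  have hm := mem_grid hh h0
  have hu := abs_sampledControl_le_of_decay hh hq hq1 hα hZ hs hy hdy hI hk (hm.1.trans htT)
  have h5 : Real.exp (-α * (⌊t / h⌋₊ * h)) ≤ Real.exp α * Real.exp (-α * t) := by
    have := exp_neg_mul_le_shift (c := 1) (s := ⌊t / h⌋₊ * h) (t := t) hα (by linarith [hm.2])
    rwa [mul_one] at this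
  have hU : 0 ≤ |kp| + |kd| * Real.exp α + κ := by positivity
  have hu' := hu.trans (mul_le_mul_of_nonneg_left (mul_le_mul_of_nonneg_left h5 hZ) hU)
  refine (abs_eventAccel_le hσ hσ1 hu' (hy t h0 htT) (hdy t h0 htT)).trans (le_of_eq ?_)
  ring

/-- The event-triggered control differs little from the continuous PID control. -/
theorem abs_eventControl_sub_pid_le (hh : 0 < h) (hh1 : h ≤ 1) (hq : 0 < q) (hq1 : q * h ≤ 1)
    (hα : 0 ≤ α) (hZ : 0 ≤ Z) (hκ : 0 ≤ κ) (hσ : 0 ≤ σ) (hσ1 : σ ≤ 1)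
    (hs : IsEventSolution a₁ a₂ b h q (kp + kd / (q * h)) ki (-(kd / (q * h))) σ y dy)
    (hy : ∀ s, 0 ≤ s → s ≤ T → |y s| ≤ Z * Real.exp (-α * s))
    (hdy : ∀ s, 0 ≤ s → s ≤ T → |dy s| ≤ Z * Real.exp (-α * s))
    (hI : ∀ s, 0 ≤ s → s ≤ T → |ki * integralState h y s| ≤ κ * Z * Real.exp (-α * s))
    {t : ℝ} (ht : 2 * (q * h) ≤ t) (htT : t ≤ T) :
    |eventControl σ (sampledControl h q (kp + kd / (q * h)) ki (-(kd / (q * h))) y) ⌊t / h⌋₊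
        - (kp * y t + ki * integralState h y t + kd * dy t)| ≤
      (√σ * (|kp| + |kd| * Real.exp α + κ) + (|kp| + |ki|) * h + |kd| * (q * h + h) *
        (2 * |b| * ((|kp| + |kd| * Real.exp α + κ) * Real.exp α) + |a₁| + |a₂|)) *
        Real.exp (2 * α) * (Z * Real.exp (-α * t)) := by
  have hτ : 0 < q * h := by positivity
  have h0 : 0 ≤ t := by linarith
  have hm := mem_grid hh h0
  have hk2 : 2 * q ≤ ⌊t / h⌋₊ := Nat.le_floor ((le_div_iff₀ hh).2 (by push_cast; linarith))
  have hk : q ≤ ⌊t / h⌋₊ := by omega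
  set k := ⌊t / h⌋₊ with hkdef
  set U := |kp| + |kd| * Real.exp α + κ with hU
  have hU0 : 0 ≤ U := by positivity
  set L := 2 * |b| * (U * Real.exp α) + |a₁| + |a₂| with hL
  have hL0 : 0 ≤ L := by positivity
  set u := sampledControl h q (kp + kd / (q * h)) ki (-(kd / (q * h))) y with hu
  have hkT : (k : ℝ) * h ≤ T := hm.1.trans htT
  have hk0 : 0 ≤ (k : ℝ) * h := by positivity
  have hkq : (q : ℝ) * h ≤ k * h - q * h := by
    have : (2 : ℝ) * q ≤ k := by exact_mod_cast hk2
    nlinarith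
  have hueq : u k = _ := sampledControl_eq hh hk
  have huk := abs_sampledControl_le_of_decay hh hq hq1 hα hZ hs hy hdy hI hk hkT
  set W := Real.exp (2 * α) * (Z * Real.exp (-α * t)) with hW
  have hW0 : 0 ≤ W := by positivity
  have hshift : ∀ s, t - 2 ≤ s → Z * Real.exp (-α * s) ≤ W := by
    intro s h1
    have := mul_le_mul_of_nonneg_left (exp_neg_mul_le_shift hα h1) hZ
    rw [mul_comm α 2] at this
    rw [hW]; linarith
  have hkW : Z * Real.exp (-α * (k * h)) ≤ W := hshift _ (by linarith [hm.2])
  set τ : ℝ := q * h with hτdef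
  -- the triggering error
  have t1 : |eventControl σ u k - u k| ≤ √σ * U * W := by
    refine (abs_eventControl_sub_le hσ u k).trans ?_
    rw [mul_assoc]
    exact mul_le_mul_of_nonneg_left (huk.trans (mul_le_mul_of_nonneg_left hkW hU0))
      (Real.sqrt_nonneg _)
  -- the sampling error
  have t2 : |y (k * h) - y t| ≤ h * W := by
    rw [abs_sub_comm]
    refine (hs.abs_sub_le hk0 hm.1 htT hα hZ hdy).trans ?_
    exact mul_le_mul (by linarith [hm.2]) hkW (by positivity) hh.le
  have t3 : |integralState h y (k * h) - integralState h y t| ≤ h * W := by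
    rw [abs_sub_comm]
    have := norm_image_sub_le_of_norm_deriv_right_le_segment (f := integralState h y)
      (f' := fun s => y ((⌊s / h⌋₊ : ℝ) * h)) (a := k * h) (b := t)
      (C := W) (continuous_integralState hh y).continuousOn
      (fun x hx => hasDerivWithinAt_integralState hh y (hk0.trans hx.1)) (fun x hx => by
        rw [floor_div_eq hh ⟨hx.1, hx.2.trans hm.2⟩]
        exact (hy _ hk0 hkT).trans hkW) t (right_mem_Icc.2 hm.1)
    refine this.trans ?_
    rw [mul_comm]
    exact mul_le_mul_of_nonneg_right (by linarith [hm.2]) hW0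
  -- the difference quotient
  have hacc : ∀ s, τ ≤ s → t - 2 ≤ s → s ≤ T →
      |eventAccel a₁ a₂ b h q (kp + kd / τ) ki (-(kd / τ)) σ y dy s| ≤ L * W := by
    intro s h1 h2 h3
    exact (abs_eventAccel_le_of_decay hh hh1 hq hq1 hα hZ hκ hσ hσ1 hs hy hdy hI h1 h3).trans
      (mul_le_mul_of_nonneg_left (hshift s h2) hL0)
  have hdd : ∀ s, k * h - τ ≤ s → s ≤ t → |dy t - dy s| ≤ (τ + h) * (L * W) := by
    intro s h1 h2
    have hs0 : τ ≤ s := hkq.trans h1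
    have := norm_image_sub_le_of_norm_deriv_right_le_segment (f := dy)
      (f' := eventAccel a₁ a₂ b h q (kp + kd / τ) ki (-(kd / τ)) σ y dy) (a := s) (b := t)
      (C := L * W) (hs.continuousOn_dy.mono fun x hx => hτ.le.trans (hs0.trans hx.1))
      (fun x hx => hs.hasDeriv_dy_right hh (hτ.le.trans (hs0.trans hx.1)))
      (fun x hx => hacc x (hs0.trans hx.1) (by linarith [hx.1, hm.2]) (hx.2.le.trans htT))
      t (right_mem_Icc.2 h2)
    refine this.trans ?_
    rw [mul_comm]
    exact mul_le_mul_of_nonneg_right (by linarith [hm.2]) (by positivity)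
  have t4 : |(y (k * h) - y (k * h - τ)) / τ - dy t| ≤ (τ + h) * (L * W) := by
    have h1 := norm_image_sub_le_of_norm_deriv_right_le_segment (f := fun s => y s - dy t * s)
      (f' := fun s => dy s - dy t) (a := k * h - τ) (b := k * h)
      (C := (τ + h) * (L * W))
      (ContinuousOn.sub (hs.continuousOn_y.mono fun x hx => hτ.le.trans (hkq.trans hx.1))
        (by fun_prop))
      (fun x hx => ((hs.hasDeriv_y_right (hτ.le.trans (hkq.trans hx.1))).sub
        ((hasDerivAt_id x).const_mul (dy t)).hasDerivWithinAt).congr_deriv (by simp))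
      (fun x hx => by
        rw [Real.norm_eq_abs, abs_sub_comm]
        exact hdd x hx.1 (hx.2.le.trans hm.1)) (k * h) (right_mem_Icc.2 (by linarith))
    have e : (y (k * h) - y (k * h - τ)) / τ - dy t =
        (y (k * h) - dy t * (k * h) - (y (k * h - τ) - dy t * (k * h - τ))) / τ := by
      field_simp; ring
    rw [e, abs_div, abs_of_pos hτ, div_le_iff₀ hτ]
    rwa [sub_sub_cancel] at h1
  have e : eventControl σ u k - (kp * y t + ki * integralState h y t + kd * dy t) =
      (eventControl σ u k - u k) + (kp * (y (k * h) - y t)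
        + ki * (integralState h y (k * h) - integralState h y t)
        + kd * ((y (k * h) - y (k * h - τ)) / τ - dy t)) := by
    rw [hueq]; ring
  rw [e]
  refine (abs_add_le _ _).trans ?_
  have t5 : |kp * (y (k * h) - y t) + ki * (integralState h y (k * h) - integralState h y t)
        + kd * ((y (k * h) - y (k * h - τ)) / τ - dy t)| ≤
      |kp| * (h * W) + |ki| * (h * W) + |kd| * ((τ + h) * (L * W)) := by
    refine (abs_add_three _ _ _).trans ?_
    simp only [abs_mul kp, abs_mul ki, abs_mul kd]
    exact add_le_add (add_le_add (mul_le_mul_of_nonneg_left t2 (abs_nonneg _))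
      (mul_le_mul_of_nonneg_left t3 (abs_nonneg _))) (mul_le_mul_of_nonneg_left t4 (abs_nonneg _))
  refine (add_le_add t1 t5).trans (le_of_eq ?_)
  rw [hW]; ring

/-- The sampled value of the output differs little from its current value. -/
theorem abs_sample_sub_le (hh : 0 < h) (hh1 : h ≤ 1) (hα : 0 ≤ α) (hZ : 0 ≤ Z)
    (hs : IsEventSolution a₁ a₂ b h q kp ki kd σ y dy)
    (hdy : ∀ s, 0 ≤ s → s ≤ T → |dy s| ≤ Z * Real.exp (-α * s)) {t : ℝ} (ht : 0 ≤ t)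
    (htT : t ≤ T) :
    |y ((⌊t / h⌋₊ : ℝ) * h) - y t| ≤ h * Real.exp (2 * α) * (Z * Real.exp (-α * t)) := by
  have hm := mem_grid hh ht
  rw [abs_sub_comm]
  refine (hs.abs_sub_le (by positivity) hm.1 htT hα hZ hdy).trans ?_
  have h1 := exp_neg_mul_le_shift (c := 2) (s := ⌊t / h⌋₊ * h) (t := t) hα (by linarith [hm.2])
  rw [mul_comm α 2] at h1
  have h2 := mul_le_mul_of_nonneg_left h1 hZ
  calc _ ≤ h * (Z * (Real.exp (2 * α) * Real.exp (-α * t))) :=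
        mul_le_mul (by linarith [hm.2]) h2 (by positivity) hh.le
    _ = _ := by ring

/-- The discrete delay tends to zero with the sampling period. -/
theorem delayOf_bounds (hh : 0 < h) (hh1 : h ≤ 1) :
    0 < delayOf h ∧ (delayOf h : ℝ) * h ≤ √h := by
  have hs : 0 < √h := Real.sqrt_pos.2 hh
  have e : h ^ (-(1 / 2) : ℝ) = (√h)⁻¹ := by
    rw [Real.rpow_neg hh.le, Real.sqrt_eq_rpow]
  unfold delayOf
  rw [e]
  constructor
  · rw [Nat.floor_pos]
    exact (one_le_inv₀ hs).2 (Real.sqrt_le_one.2 hh1)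
  · have h1 : (⌊(√h)⁻¹⌋₊ : ℝ) ≤ (√h)⁻¹ := Nat.floor_le (by positivity)
    calc _ ≤ (√h)⁻¹ * h := mul_le_mul_of_nonneg_right h1 hh.le
      _ = (√h)⁻¹ * (√h * √h) := by rw [Real.mul_self_sqrt hh.le]
      _ = √h := by field_simp

/-- The perturbation is as small as we please for small sampling periods and thresholds. -/
theorem exists_small_perturbation {c₁ c₂ c₃ ε : ℝ} (hc₁ : 0 ≤ c₁) (hc₂ : 0 ≤ c₂) (hc₃ : 0 ≤ c₃)
    (hε : 0 < ε) : ∃ h₀ > 0, ∃ σ₀ > 0, h₀ ≤ 1 ∧ ∀ h σ : ℝ, 0 < h → h < h₀ → 0 ≤ σ → σ < σ₀ →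
      √σ * c₁ + c₂ * h + (delayOf h * h + h) * c₃ ≤ ε := by
  set δ := ε / (2 * (c₁ + c₂ + 2 * c₃ + 1)) with hδ
  have hc : 0 < c₁ + c₂ + 2 * c₃ + 1 := by positivity
  have hδ0 : 0 < δ := by positivity
  refine ⟨min 1 (δ ^ 2), by positivity, δ ^ 2, by positivity, min_le_left _ _,
    fun h σ hh hh0 hσ hσ0 => ?_⟩
  have hh1 : h ≤ 1 := (hh0.trans_le (min_le_left _ _)).le
  have h1 : √h ≤ δ := Real.sqrt_le_iff.2 ⟨hδ0.le, (hh0.trans_le (min_le_right _ _)).le⟩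
  have h2 : √σ ≤ δ := Real.sqrt_le_iff.2 ⟨hδ0.le, hσ0.le⟩
  have h3 : h ≤ √h := by
    have h4 : √h ≤ 1 := Real.sqrt_le_one.2 hh1
    have h5 := Real.mul_self_sqrt hh.le
    nlinarith [Real.sqrt_nonneg h]
  have h4 := (delayOf_bounds hh hh1).2
  have h5 : √σ * c₁ ≤ δ * c₁ := mul_le_mul_of_nonneg_right h2 hc₁
  have h6 : c₂ * h ≤ c₂ * δ := mul_le_mul_of_nonneg_left (h3.trans h1) hc₂
  have h7 : (delayOf h * h + h) * c₃ ≤ (2 * δ) * c₃ :=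
    mul_le_mul_of_nonneg_right (by linarith) hc₃
  have h8 : δ * (c₁ + c₂ + 2 * c₃ + 1) = ε / 2 := by rw [hδ]; field_simp
  linarith

end Perturbation

section Implementation

/-! ### Sampled-data implementation of a continuous PID controller -/

variable {a₁ a₂ b kp ki kd α β M : ℝ}

theorem small_gain_of_small {ε δ : ℝ} (hM : 0 ≤ M) (hδ : 0 < δ) (hε : ε ≤ δ / (2 * (M + 1))) :
    M * ε / δ ≤ 1 / 2 := by
  rw [div_le_iff₀ hδ]
  have h1 : 0 < M + 1 := by linarith
  have h2 := mul_le_mul_of_nonneg_left hε hM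
  have h3 : M * (δ / (2 * (M + 1))) ≤ (M + 1) * (δ / (2 * (M + 1))) :=
    mul_le_mul_of_nonneg_right (by linarith) (by positivity)
  have h4 : (M + 1) * (δ / (2 * (M + 1))) = 1 / 2 * δ := by field_simp
  linarith

theorem exists_eventStabilizesFull (hM : 0 ≤ M)
    (hA : SemigroupDecays (generatorPID a₁ a₂ b kp ki kd) M β) (hβ : 0 < β) (hαβ : α < β) :
    ∃ h₀ > 0, ∃ σ₀ > 0, ∀ h σ : ℝ, 0 < h → h < h₀ → 0 ≤ σ → σ < 1 → σ < σ₀ →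
      EventStabilizesFull a₁ a₂ b h (delayOf h) (kp + kd / (delayOf h * h)) ki
        (-(kd / (delayOf h * h))) σ α := by
  set γ := max α 0 with hγ
  have hγ0 : 0 ≤ γ := le_max_right _ _
  have hγβ : γ < β := max_lt hαβ hβ
  set U := |kp| + |kd| * Real.exp γ + |ki| with hU
  set L := 2 * |b| * (U * Real.exp γ) + |a₁| + |a₂| with hL
  set B := (|b| + 1) * Real.exp (2 * γ) with hB
  have hU0 : 0 ≤ U := by positivity
  have hL0 : 0 ≤ L := by positivity
  have hB0 : 0 ≤ B := by positivity
  obtain ⟨h₀, hh₀, σ₀, hσ₀, hle, hsmall⟩ := exists_small_perturbation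
    (c₁ := B * U) (c₂ := B * (|kp| + |ki| + 1)) (c₃ := B * (|kd| * L))
    (ε := (β - γ) / (2 * (M + 1))) (by positivity) (by positivity) (by positivity)
    (div_pos (sub_pos.2 hγβ) (by positivity))
  refine ⟨h₀, hh₀, σ₀, hσ₀, fun h σ hh hhh₀ hσ hσ1 hσσ₀ => ?_⟩
  have hh1 : h ≤ 1 := hhh₀.le.trans hle
  obtain ⟨hq, hqh⟩ := delayOf_bounds hh hh1
  have hε := hsmall h σ hh hhh₀ hσ hσσ₀
  set q := delayOf h with hqdef
  have hq1 : q * h ≤ 1 := hqh.trans (Real.sqrt_le_one.2 hh1)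
  obtain ⟨C, hC0, hC⟩ := exists_state_bound a₁ a₂ b hh q (kp + kd / (q * h)) ki
    (-(kd / (q * h))) hσ hσ1.le (2 * q)
  set t₀ : ℝ := 2 * (q * h) with ht₀
  have ht₀0 : 0 ≤ t₀ := by positivity
  set ε := √σ * (B * U) + B * (|kp| + |ki| + 1) * h + (q * h + h) * (B * (|kd| * L)) with hεdef
  have hε0 : 0 ≤ ε := by positivity
  refine eventStabilizesFull_of_bound hh (M := (2 * M + 1) * Real.exp (γ * t₀) * C)
    fun y dy hy hdy hs T hT => ?_
  set r := |y 0| + |dy 0| with hr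
  have key := norm_le_of_small_gain (X := fun t => (y t, dy t, integralState h y t))
    (d := fun t => ((0 : ℝ), b * (eventControl σ (sampledControl h q (kp + kd / (q * h)) ki
      (-(kd / (q * h))) y) ⌊t / h⌋₊ - (kp * y t + ki * integralState h y t + kd * dy t)),
      y ((⌊t / h⌋₊ : ℝ) * h) - y t)) (D := C * r) hM hγ0 hγβ hA hε0
    (small_gain_of_small hM (sub_pos.2 hγβ) hε) ht₀0 ?_ ?_ ?_ ?_ hT
  · have hexp : Real.exp (-γ * T) ≤ Real.exp (-α * T) := by
      refine Real.exp_le_exp.2 ?_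
      have : α * T ≤ γ * T := mul_le_mul_of_nonneg_right (le_max_left _ _) hT
      linarith
    have hfin : (2 * M + 1) * Real.exp (γ * t₀) * (C * r) * Real.exp (-γ * T) ≤
        (2 * M + 1) * Real.exp (γ * t₀) * C * Real.exp (-α * T) * r := by
      have := mul_le_mul_of_nonneg_left hexp
        (show 0 ≤ (2 * M + 1) * Real.exp (γ * t₀) * (C * r) by positivity)
      linarith
    have k := key.trans hfin
    have k2 := (norm_snd_le (y T, dy T, integralState h y T)).trans k
    rw [sampledIntegral_eq_integral hh y hT]
    exact ⟨(norm_fst_le (y T, dy T, integralState h y T)).trans k,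
      (norm_fst_le (dy T, integralState h y T)).trans k2,
      (norm_snd_le (dy T, integralState h y T)).trans k2⟩
  · exact (hy.prodMk (hdy.prodMk (continuous_integralState hh y))).continuousOn
  · intro t ht
    have h0 : 0 ≤ t := ht₀0.trans ht
    refine ((hs.hasDeriv_y_right h0).prodMk ((hs.hasDeriv_dy_right hh h0).prodMk
      (hasDerivWithinAt_integralState hh y h0))).congr_deriv ?_
    rw [generatorPID_apply]
    simp only [eventAccel, Prod.mk_add_mk, Prod.mk.injEq]
    exact ⟨by ring, by ring, by ring⟩
  · intro T Z hZ hX t ht htT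
    have h0 : 0 ≤ t := ht₀0.trans ht
    have hyb : ∀ s, 0 ≤ s → s ≤ T → |y s| ≤ Z * Real.exp (-γ * s) := fun s h1 h2 =>
      (norm_fst_le (y s, dy s, integralState h y s)).trans (hX s h1 h2)
    have bsnd : ∀ s, 0 ≤ s → s ≤ T → ‖(dy s, integralState h y s)‖ ≤ Z * Real.exp (-γ * s) :=
      fun s h1 h2 => (norm_snd_le (y s, dy s, integralState h y s)).trans (hX s h1 h2)
    have bdy : ∀ s, 0 ≤ s → s ≤ T → |dy s| ≤ Z * Real.exp (-γ * s) := fun s h1 h2 =>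
      (norm_fst_le (dy s, integralState h y s)).trans (bsnd s h1 h2)
    have bI : ∀ s, 0 ≤ s → s ≤ T → |ki * integralState h y s| ≤ |ki| * Z * Real.exp (-γ * s) := by
      intro s h1 h2
      rw [abs_mul, mul_assoc]
      exact mul_le_mul_of_nonneg_left
        ((norm_snd_le (dy s, integralState h y s)).trans (bsnd s h1 h2)) (abs_nonneg _)
    have e1 := abs_eventControl_sub_pid_le hh hh1 hq hq1 hγ0 hZ (abs_nonneg ki) hσ hσ1.le hs hyb
      bdy bI ht htT
    have e2 := abs_sample_sub_le hh hh1 hγ0 hZ hs bdy h0 htT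
    set V := Real.exp (2 * γ) * (Z * Real.exp (-γ * t)) with hV
    have hV0 : 0 ≤ V := by positivity
    set η := √σ * U + (|kp| + |ki|) * h + |kd| * (q * h + h) * L with hη
    have hη0 : 0 ≤ η := by positivity
    have e3 : ε * Z * Real.exp (-γ * t) = (|b| + 1) * (η + h) * V := by
      rw [hεdef, hV, hη, hB]; ring
    have e4 : 0 ≤ |b| * η * V := by positivity
    have e5 : 0 ≤ |b| * h * V := by positivity
    have e6 : 0 ≤ η * V := by positivity
    have e7 : 0 ≤ h * V := by positivity
    rw [mul_assoc _ (Real.exp (2 * γ)) _, ← hV] at e1 e2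
    rw [e3]
    refine max_le ?_ (max_le ?_ ?_)
    · rw [norm_zero]; positivity
    · rw [Real.norm_eq_abs, abs_mul]
      have := mul_le_mul_of_nonneg_left e1 (abs_nonneg b)
      change |b| * _ ≤ |b| * (η * V) at this
      refine this.trans ?_
      linarith
    · refine le_trans e2 ?_
      linarith
  · intro s h1 h2
    obtain ⟨c1, c2, c3, -⟩ := hC y dy hs s h1 (by push_cast; linarith)
    exact max_le c1 (max_le c2 c3)

theorem exists_eventStabilizes (hb : b * ki = 0) (hM : 0 ≤ M)
    (hA : SemigroupDecays (generatorPD a₁ a₂ b kp kd) M β) (hβ : 0 < β) (hαβ : α < β) :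
    ∃ h₀ > 0, ∃ σ₀ > 0, ∀ h σ : ℝ, 0 < h → h < h₀ → 0 ≤ σ → σ < 1 → σ < σ₀ →
      EventStabilizes a₁ a₂ b h (delayOf h) (kp + kd / (delayOf h * h)) ki
        (-(kd / (delayOf h * h))) σ α := by
  set γ := max α 0 with hγ
  have hγ0 : 0 ≤ γ := le_max_right _ _
  have hγβ : γ < β := max_lt hαβ hβ
  set U := |kp| + |kd| * Real.exp γ + 0 with hU
  set L := 2 * |b| * (U * Real.exp γ) + |a₁| + |a₂| with hL
  set B := |b| * Real.exp (2 * γ) with hB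
  have hU0 : 0 ≤ U := by positivity
  have hL0 : 0 ≤ L := by positivity
  have hB0 : 0 ≤ B := by positivity
  obtain ⟨h₀, hh₀, σ₀, hσ₀, hle, hsmall⟩ := exists_small_perturbation
    (c₁ := B * U) (c₂ := B * (|kp| + |ki|)) (c₃ := B * (|kd| * L))
    (ε := (β - γ) / (2 * (M + 1))) (by positivity) (by positivity) (by positivity)
    (div_pos (sub_pos.2 hγβ) (by positivity))
  refine ⟨h₀, hh₀, σ₀, hσ₀, fun h σ hh hhh₀ hσ hσ1 hσσ₀ => ?_⟩
  have hh1 : h ≤ 1 := hhh₀.le.trans hle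
  obtain ⟨hq, hqh⟩ := delayOf_bounds hh hh1
  have hε := hsmall h σ hh hhh₀ hσ hσσ₀
  set q := delayOf h with hqdef
  have hq1 : q * h ≤ 1 := hqh.trans (Real.sqrt_le_one.2 hh1)
  obtain ⟨C, hC0, hC⟩ := exists_state_bound a₁ a₂ b hh q (kp + kd / (q * h)) ki
    (-(kd / (q * h))) hσ hσ1.le (2 * q)
  set t₀ : ℝ := 2 * (q * h) with ht₀
  have ht₀0 : 0 ≤ t₀ := by positivity
  set ε := √σ * (B * U) + B * (|kp| + |ki|) * h + (q * h + h) * (B * (|kd| * L)) with hεdef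
  have hε0 : 0 ≤ ε := by positivity
  refine eventStabilizes_of_bound (M := (2 * M + 1) * Real.exp (γ * t₀) * C)
    fun y dy hs T hT => ?_
  set r := |y 0| + |dy 0| with hr
  have key := norm_le_of_small_gain (X := fun t => (y t, dy t))
    (d := fun t => ((0 : ℝ), b * (eventControl σ (sampledControl h q (kp + kd / (q * h)) ki
      (-(kd / (q * h))) y) ⌊t / h⌋₊ - (kp * y t + ki * integralState h y t + kd * dy t))))
    (D := C * r) hM hγ0 hγβ hA hε0
    (small_gain_of_small hM (sub_pos.2 hγβ) hε) ht₀0 ?_ ?_ ?_ ?_ hT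
  · have hexp : Real.exp (-γ * T) ≤ Real.exp (-α * T) := by
      refine Real.exp_le_exp.2 ?_
      have : α * T ≤ γ * T := mul_le_mul_of_nonneg_right (le_max_left _ _) hT
      linarith
    have hfin : (2 * M + 1) * Real.exp (γ * t₀) * (C * r) * Real.exp (-γ * T) ≤
        (2 * M + 1) * Real.exp (γ * t₀) * C * Real.exp (-α * T) * r := by
      have := mul_le_mul_of_nonneg_left hexp
        (show 0 ≤ (2 * M + 1) * Real.exp (γ * t₀) * (C * r) by positivity)
      linarith
    have k := key.trans hfin
    exact ⟨(norm_fst_le (y T, dy T)).trans k, (norm_snd_le (y T, dy T)).trans k⟩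
  · exact hs.continuousOn_y.prodMk hs.continuousOn_dy
  · intro t ht
    have h0 : 0 ≤ t := ht₀0.trans ht
    refine ((hs.hasDeriv_y_right h0).prodMk (hs.hasDeriv_dy_right hh h0)).congr_deriv ?_
    rw [generatorPD_apply]
    simp only [eventAccel, Prod.mk_add_mk, Prod.mk.injEq]
    exact ⟨by ring, by linear_combination integralState h y t * hb⟩
  · intro T Z hZ hX t ht htT
    have h0 : 0 ≤ t := ht₀0.trans ht
    rcases eq_or_ne b 0 with hb0 | hb0
    · simp only [hb0, zero_mul, Prod.mk_zero_zero, norm_zero]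
      positivity
    have hki : ki = 0 := (mul_eq_zero.1 hb).resolve_left hb0
    have hyb : ∀ s, 0 ≤ s → s ≤ T → |y s| ≤ Z * Real.exp (-γ * s) := fun s h1 h2 =>
      (norm_fst_le (y s, dy s)).trans (hX s h1 h2)
    have bdy : ∀ s, 0 ≤ s → s ≤ T → |dy s| ≤ Z * Real.exp (-γ * s) := fun s h1 h2 =>
      (norm_snd_le (y s, dy s)).trans (hX s h1 h2)
    have bI : ∀ s, 0 ≤ s → s ≤ T → |ki * integralState h y s| ≤ 0 * Z * Real.exp (-γ * s) := by
      intro s _ _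
      simp [hki]
    have e1 := abs_eventControl_sub_pid_le hh hh1 hq hq1 hγ0 hZ le_rfl hσ hσ1.le hs hyb
      bdy bI ht htT
    set V := Real.exp (2 * γ) * (Z * Real.exp (-γ * t)) with hV
    set η := √σ * U + (|kp| + |ki|) * h + |kd| * (q * h + h) * L with hη
    have e3 : ε * Z * Real.exp (-γ * t) = |b| * (η * V) := by
      rw [hεdef, hV, hη, hB]; ring
    rw [mul_assoc _ (Real.exp (2 * γ)) _, ← hV] at e1
    rw [e3]
    refine max_le ?_ ?_
    · rw [norm_zero]; positivity
    · rw [Real.norm_eq_abs, abs_mul]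
      exact mul_le_mul_of_nonneg_left e1 (abs_nonneg b)
  · intro s h1 h2
    obtain ⟨c1, c2, -, -⟩ := hC y dy hs s h1 (by push_cast; linarith)
    exact max_le c1 c2

end Implementation

end PID

theorem theorem3 (a₁ a₂ b : ℝ) :
    (∀ (h : ℝ) (q : ℕ) (kp ki kd σ α : ℝ),
      0 < h → 0 < q → 0 ≤ σ → σ < 1 → 0 < α →
      PID.LMIFeasible a₁ a₂ b h q kp ki kd σ α →
        PID.EventStabilizes a₁ a₂ b h q kp ki kd σ α ∧
        PID.EventStabilizesFull a₁ a₂ b h q kp ki kd σ α) ∧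
    (∀ kp' ki' kd' α' : ℝ, 0 < α' →
      (PID.PIDStabilizes a₁ a₂ b kp' ki' kd' α' →
        ∀ α : ℝ, α < α' → ∃ h₀ > 0, ∃ σ₀ > 0, ∀ h σ : ℝ, 0 < h → h < h₀ →
          0 ≤ σ → σ < 1 → σ < σ₀ →
          PID.EventStabilizes a₁ a₂ b h (PID.delayOf h)
            (kp' + kd' / (PID.delayOf h * h)) ki' (-(kd' / (PID.delayOf h * h))) σ α) ∧
      (PID.PIDStabilizesFull a₁ a₂ b kp' ki' kd' α' →
        ∀ α : ℝ, α < α' → ∃ h₀ > 0, ∃ σ₀ > 0, ∀ h σ : ℝ, 0 < h → h < h₀ →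
          0 ≤ σ → σ < 1 → σ < σ₀ →
          PID.EventStabilizesFull a₁ a₂ b h (PID.delayOf h)
            (kp' + kd' / (PID.delayOf h * h)) ki' (-(kd' / (PID.delayOf h * h))) σ α)) := by
  refine ⟨fun h q kp ki kd σ α hh hq hσ hσ1 hα hL => ?_, fun kp ki kd β hβ => ⟨?_, ?_⟩⟩
  · have H := PID.eventStabilizesFull_of_LMIFeasible hh hq hσ hσ1 hα.le hL
    exact ⟨H.eventStabilizes, H⟩
  · intro H α hαβ
    by_cases hb : b * ki = 0
    · obtain ⟨M, hM, hA⟩ := PID.semigroupDecays_generatorPD hb H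
      exact PID.exists_eventStabilizes hb hM hA hβ hαβ
    · obtain ⟨M, hM, hA⟩ := PID.semigroupDecays_generatorPID
        (PID.exists_integral_bound hb hβ.le H)
      obtain ⟨h₀, hh₀, σ₀, hσ₀, hfin⟩ := PID.exists_eventStabilizesFull hM hA hβ hαβ
      exact ⟨h₀, hh₀, σ₀, hσ₀, fun h σ hh hhh₀ hσ hσ1 hσσ₀ =>
        (hfin h σ hh hhh₀ hσ hσ1 hσσ₀).eventStabilizes⟩
  · intro H α hαβ
    obtain ⟨M, hM, hA⟩ := PID.semigroupDecays_generatorPID H.exists_bound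
    exact PID.exists_eventStabilizesFull hM hA hβ hαβ
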